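/- Let $n_1,n_2\ge 1$ be integers, let $\Lambda_1,\Lambda_2>0$ be real numbers, and put $q_i=\Lambda_i/(n_i+2)$. For $Y=(Y_1,Y_2)\in\mathbb{R}^2$ let $$E(Y)=\tfrac12+4n_1q_1^2Y_1^2+4n_2q_2^2Y_2^2,\qquad F_i(Y)=2(n_i+2)q_iY_i-6q_i^2Y_i^2-E(Y)\quad(i=1,2),$$ and consider the system $$\frac{dY_i}{du}=-Y_iF_i(Y),\qquad i=1,2.$$ Let $\Omega_1=\{Y\in\mathbb{R}^2: F_1(Y)\ge 0,\ F_2(Y)\ge 0\}$. The system has exactly two stationary points with both coordinates nonzero; they can be named $\xi=(\xi_1,\xi_2)$ and $\eta=(\eta_1,\eta_2)$ so that $0<\eta_1<\xi_1$ and $0<\eta_2<\xi_2$. Moreover: (i) For every $p\in\Omega_1\setminus\{\xi\}$ there is a solution $Y(u)$ with $Y(0)=p$ defined for all $u\ge 0$, and every solution on $[0,\infty)$ with $Y(0)=p$ satisfies $\lim_{u\to\infty}Y(u)=\eta$. (ii) Up to translation of the parameter $u$, there is exactly one solution $Y(u)$, $u\in\mathbb{R}$, with $Y(0)\in\Omega_1\setminus\{\xi\}$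 and $\lim_{u\to-\infty}Y(u)=\xi$. (iii) Let $\rho_1(\xi)\ge\rho_2(\xi)$ be the eigenvalues of $$\alpha_\xi=\begin{pmatrix}(8n_1+6)q_1^2\xi_1^2&8n_2q_2^2\xi_2^2\\ 8n_1q_1^2\xi_1^2&(8n_2+6)q_2^2\xi_2^2\end{pmatrix}.$$ These are real, and the eigenvalues of the Jacobian matrix at $\xi$ of the vector field $(-Y_1F_1,-Y_2F_2)$ are $-E(\xi)+\rho_1(\xi)$ and $-E(\xi)+\rho_2(\xi)$, with $-E(\xi)+\rho_2(\xi)<0<-E(\xi)+\rho_1(\xi)$. -/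

import Mathlib

open Set Filter Topology

noncomputable section

namespace QKFlow

/-- `q_i = Λ_i / (n_i + 2)`. -/
def q (n : Fin 2 → ℕ) (Λ : Fin 2 → ℝ) (i : Fin 2) : ℝ := Λ i / ((n i : ℝ) + 2)

/-- `E(Y) = 1/2 + 4 n₁ q₁² Y₁² + 4 n₂ q₂² Y₂²`. -/
def E (n : Fin 2 → ℕ) (Λ : Fin 2 → ℝ) (Y : Fin 2 → ℝ) : ℝ :=
  1 / 2 + ∑ i, 4 * (n i : ℝ) * q n Λ i ^ 2 * Y i ^ 2

/-- `F_i(Y) = 2 (n_i + 2) q_i Y_i - 6 q_i² Y_i² - E(Y)`. -/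
def F (n : Fin 2 → ℕ) (Λ : Fin 2 → ℝ) (i : Fin 2) (Y : Fin 2 → ℝ) : ℝ :=
  2 * ((n i : ℝ) + 2) * q n Λ i * Y i - 6 * q n Λ i ^ 2 * Y i ^ 2 - E n Λ Y

/-- The vector field `(-Y₁ F₁(Y), -Y₂ F₂(Y))` on the plane. -/
def field (n : Fin 2 → ℕ) (Λ : Fin 2 → ℝ) (Y : Fin 2 → ℝ) : Fin 2 → ℝ :=
  fun i => -(Y i * F n Λ i Y)

/-- `Y` solves `dY_i/du = -Y_i F_i(Y)`, `i = 1, 2`, on the interval `J`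
(with one-sided derivatives at endpoints belonging to `J`). -/
def IsSolutionOn (n : Fin 2 → ℕ) (Λ : Fin 2 → ℝ) (Y : ℝ → Fin 2 → ℝ) (J : Set ℝ) : Prop :=
  ∀ u ∈ J, HasDerivWithinAt Y (field n Λ (Y u)) J u

/-- The region `Ω₁ = {Y : F₁(Y) ≥ 0 and F₂(Y) ≥ 0}`. -/
def Omega1 (n : Fin 2 → ℕ) (Λ : Fin 2 → ℝ) : Set (Fin 2 → ℝ) :=
  {Y | ∀ i, 0 ≤ F n Λ i Y}

/-- The Jacobian matrix of the vector field at the point `Y`. -/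
def jacobian (n : Fin 2 → ℕ) (Λ : Fin 2 → ℝ) (Y : Fin 2 → ℝ) : Matrix (Fin 2) (Fin 2) ℝ :=
  LinearMap.toMatrix' (fderiv ℝ (field n Λ) Y).toLinearMap

/-- The matrix `α_χ`, with rows `((8n₁+6) q₁² χ₁², 8 n₂ q₂² χ₂²)` and
`(8 n₁ q₁² χ₁², (8n₂+6) q₂² χ₂²)`. -/
def alpha (n : Fin 2 → ℕ) (Λ : Fin 2 → ℝ) (χ : Fin 2 → ℝ) : Matrix (Fin 2) (Fin 2) ℝ :=
  !![(8 * (n 0 : ℝ) + 6) * q n Λ 0 ^ 2 * χ 0 ^ 2, 8 * (n 1 : ℝ) * q n Λ 1 ^ 2 * χ 1 ^ 2;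
     8 * (n 0 : ℝ) * q n Λ 0 ^ 2 * χ 0 ^ 2, (8 * (n 1 : ℝ) + 6) * q n Λ 1 ^ 2 * χ 1 ^ 2]

end QKFlow

end

/-!
The vector field is `-Y_i F_i(Y)`, where the rates `F_i(Y) = a_i Y_i - b_i Y_i² - E(Y)` are strictly
concave quadratics that share the term `E`. The proof rests on four observations.

*Order.* In the region `Ω₁ = {F₀ ≥ 0, F₁ ≥ 0}` each coordinate lies below the vertex of the parabola
`a_i y - b_i y²`. A stationary point off the axes satisfies `a_i Y_i - b_i Y_i² = E(Y)` for both `i`,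
so any two are strictly ordered in both coordinates. Concavity of the rates shows that the larger of
two ordered stationary points is a maximal element of the region (`eq_of_le_of_lt`), so there are at
most two; the intermediate value theorem along the curve of smaller roots of `a_i y - b_i y² = e`
provides two of them (`exists_stationary_points`). The same concavity argument makes the Jacobian
determinant negative at the larger point `ξ` (`saddle_of_lt`).

*Cooperation.* Along a solution the rates satisfy a linear system with nonnegative off-diagonal
coefficients `2 c_j Y_j²`, so the region is forward invariant, and so is the set where both rates are
nonpositive (`mul_rate_nonneg`). In the region both coordinates are nonincreasing, so a solution
converges to a stationary point below its initial value; by maximality of `ξ` this is the smaller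
stationary point `η` unless the solution starts at `ξ` (`tendsto_of_mem_region`).

*Existence of the orbit from `ξ`.* The forward images of the region under the flow are nested compact
connected sets containing `ξ` and `η`. Their intersection contains a point with `Y₀` halfway between
`η₀` and `ξ₀`; its backward orbit stays in the region, hence is monotone and converges to `ξ`
(`exists_connecting_solution`).

*Uniqueness of the orbit.* The point `ξ` is a saddle whose linearization has positive off-diagonal
entries, so its unstable direction is a positive vector. The difference of two solutions that tend to
`ξ` at `-∞` lies in a narrow cone around that direction (`exists_cone_condition`). A solution with
initial value in `Ω₁ \ {ξ}` approaches `ξ` from below, for above `ξ` both rates are negative and this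
would persist. Two such solutions can be translated so that they agree in the unstable coordinate at
one time, and the cone condition makes them equal (`exists_shift_of_tendsto_atBot`).
-/

open scoped NNReal

/-! ### Flows and uniqueness of integral curves -/

/-- A bounded Lipschitz vector field on a Banach space has a flow defined for all times, and its
forward time maps are continuous. -/
theorem exists_global_flow {V : Type*} [NormedAddCommGroup V] [NormedSpace ℝ V] [CompleteSpace V]
    {X : V → V} {K M : ℝ≥0} (hX : LipschitzWith K X) (hM : ∀ x, ‖X x‖ ≤ M) :
    ∃ Φ : ℝ → V → V, (∀ p, Φ 0 p = p) ∧ (∀ p t, HasDerivAt (fun u => Φ u p) (X (Φ t p)) t) ∧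
      ∀ t, 0 ≤ t → Continuous (Φ t) := by
  have hlip : ∀ t : ℝ, LipschitzOnWith K ((fun _ => X : ℝ → V → V) t) univ :=
    fun t => hX.lipschitzOnWith
  have hloc : ∀ (p : V) (N : ℕ), ∃ y : ℝ → V, y 0 = p ∧
      ∀ t ∈ Ioo (-(N : ℝ)) N, HasDerivAt y (X (y t)) t := by
    intro p N
    have h0 : (0 : ℝ) ∈ Icc (-(N : ℝ)) N := by simp
    have hPL : IsPicardLindelof (fun _ : ℝ => X) (⟨0, h0⟩ : Icc (-(N : ℝ)) N) p (M * N) 0 M K :=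
      { lipschitzOnWith := fun t _ => hX.lipschitzOnWith
        continuousOn := fun x _ => continuousOn_const
        norm_le := fun t _ x _ => hM x
        mul_max_le := by simp }
    obtain ⟨y, hy0, hy⟩ := hPL.exists_eq_forall_mem_Icc_hasDerivWithinAt₀
    exact ⟨y, hy0, fun t ht => (hy t (Ioo_subset_Icc_self ht)).hasDerivAt (Icc_mem_nhds ht.1 ht.2)⟩
  choose y hy0 hy using hloc
  -- On nested intervals the local solutions agree, so they glue to a global one.
  have hagree : ∀ (p : V) (N N' : ℕ), N ≤ N' → ∀ t ∈ Ioo (-(N : ℝ)) N, y p N t = y p N' t := by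
    intro p N N' hN t ht
    have hNN : (N : ℝ) ≤ N' := by exact_mod_cast hN
    refine ODE_solution_unique_of_mem_Ioo (v := fun _ => X) (s := fun _ => univ) (K := K)
      (a := -(N : ℝ)) (b := N) (t₀ := 0) (fun t _ => hlip t) ?_ ?_ ?_ ?_ ht
    · have := ht.1.trans ht.2
      constructor <;> linarith
    · exact fun s hs => ⟨hy p N s hs, trivial⟩
    · exact fun s hs => ⟨hy p N' s ⟨by linarith [hs.1], by linarith [hs.2]⟩, trivial⟩
    · rw [hy0, hy0]
  have hmem : ∀ t : ℝ, t ∈ Ioo (-((⌈|t|⌉₊ + 1 : ℕ) : ℝ)) ((⌈|t|⌉₊ + 1 : ℕ) : ℝ) := by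
    intro t
    have := Nat.le_ceil |t|
    have h1 := abs_le.1 (le_refl |t|)
    push_cast
    constructor <;> linarith [h1.1, h1.2]
  have hval : ∀ (p : V) (N : ℕ), ∀ t ∈ Ioo (-(N : ℝ)) N, y p (⌈|t|⌉₊ + 1) t = y p N t := by
    intro p N t ht
    rcases le_total N (⌈|t|⌉₊ + 1) with h | h
    · exact (hagree p _ _ h t ht).symm
    · exact hagree p _ _ h t (hmem t)
  have hder : ∀ p t, HasDerivAt (fun u => y p (⌈|u|⌉₊ + 1) u) (X (y p (⌈|t|⌉₊ + 1) t)) t := by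
    intro p t
    refine (hy p _ t (hmem t)).congr_of_eventuallyEq ?_
    filter_upwards [Ioo_mem_nhds (hmem t).1 (hmem t).2] with u hu using hval p _ u hu
  refine ⟨fun t p => y p (⌈|t|⌉₊ + 1) t, fun p => hy0 p _, hder, fun t ht => ?_⟩
  refine (LipschitzWith.of_dist_le_mul (K := (Real.exp (K * t)).toNNReal) fun p p' => ?_).continuous
  have h := dist_le_of_trajectories_ODE (v := fun _ => X) (K := K) (a := 0) (b := t)
    (f := fun u => y p (⌈|u|⌉₊ + 1) u) (g := fun u => y p' (⌈|u|⌉₊ + 1) u) (δ := dist p p')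
    (fun _ => hX) (HasDerivAt.continuousOn fun u _ => hder p u)
    (fun u _ => (hder p u).hasDerivWithinAt) (HasDerivAt.continuousOn fun u _ => hder p' u)
    (fun u _ => (hder p' u).hasDerivWithinAt) (by rw [hy0, hy0]) t ⟨ht, le_rfl⟩
  rw [Real.coe_toNNReal _ (Real.exp_pos _).le, mul_comm]
  simpa using h

/-- Two integral curves of a `C¹` vector field on the whole line that meet once coincide. -/
theorem eq_of_hasDerivAt_of_contDiff {V : Type*} [NormedAddCommGroup V] [NormedSpace ℝ V]
    {X : V → V} (hX : ContDiff ℝ 1 X) {Y Z : ℝ → V}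
    (hY : ∀ t, HasDerivAt Y (X (Y t)) t) (hZ : ∀ t, HasDerivAt Z (X (Z t)) t) {t₀ : ℝ}
    (h : Y t₀ = Z t₀) : Y = Z := by
  have hYc : Continuous Y := continuous_iff_continuousAt.2 fun t => (hY t).continuousAt
  have hZc : Continuous Z := continuous_iff_continuousAt.2 fun t => (hZ t).continuousAt
  ext t
  obtain ⟨A, B, ht, ht₀⟩ : ∃ A B, t ∈ Ioo A B ∧ t₀ ∈ Ioo A B := by
    use (min t t₀ - 1), (max t t₀ + 1)
    grind
  have hcpt : IsCompact (Y '' Icc A B ∪ Z '' Icc A B) :=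
    (isCompact_Icc.image hYc).union (isCompact_Icc.image hZc)
  obtain ⟨K, hK⟩ := hX.locallyLipschitz.locallyLipschitzOn.exists_lipschitzOnWith_of_compact hcpt
  exact ODE_solution_unique_of_mem_Ioo (v := fun _ => X)
    (s := fun _ => Y '' Icc A B ∪ Z '' Icc A B) (fun _ _ => hK) ht₀
    (fun u hu => ⟨hY u, Or.inl ⟨u, Ioo_subset_Icc_self hu, rfl⟩⟩)
    (fun u hu => ⟨hZ u, Or.inr ⟨u, Ioo_subset_Icc_self hu, rfl⟩⟩) h ht

/-! ### Real functions and planar cooperative systems -/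

/-- If `f` converges at infinity and so does its derivative, the limit of the derivative is `0`. -/
theorem eq_zero_of_tendsto_of_tendsto_deriv {f f' : ℝ → ℝ} {a l c : ℝ}
    (hf : ∀ t, a < t → HasDerivAt f (f' t) t) (hl : Tendsto f atTop (𝓝 l))
    (hc : Tendsto f' atTop (𝓝 c)) : c = 0 := by
  have hmv : ∀ t : ℝ, ∃ s, t < s ∧ (a < t → f' s = f (t + 1) - f t) := by
    intro t
    by_cases ht : a < t
    · obtain ⟨s, hs, h⟩ := exists_hasDerivAt_eq_slope f f' (lt_add_one t)
        (HasDerivAt.continuousOn fun x hx => hf x (ht.trans_le hx.1))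
        (fun x hx => hf x (ht.trans hx.1))
      exact ⟨s, hs.1, fun _ => by simpa using h⟩
    · exact ⟨t + 1, by linarith, fun h => absurd h ht⟩
  choose s hs hfs using hmv
  have h1 : Tendsto (fun t => f' (s t)) atTop (𝓝 c) :=
    hc.comp (tendsto_atTop_mono (fun t => (hs t).le) tendsto_id)
  have h2 : Tendsto (fun t => f (t + 1) - f t) atTop (𝓝 (l - l)) :=
    (hl.comp (tendsto_atTop_add_const_right _ 1 tendsto_id)).sub hl
  rw [sub_self] at h2
  refine tendsto_nhds_unique (h1.congr' ?_) h2
  filter_upwards [eventually_gt_atTop a] with t ht using hfs t ht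

/-- The square of the negative part of a real number is continuously differentiable. -/
theorem hasDerivAt_min_zero_sq (x : ℝ) :
    HasDerivAt (fun y : ℝ => min y 0 ^ 2) (2 * min x 0) x := by
  rcases lt_trichotomy x 0 with hx | hx | hx
  · rw [min_eq_left hx.le]
    have h : HasDerivAt (fun y : ℝ => y ^ 2) (2 * x) x := by simpa using hasDerivAt_pow 2 x
    refine h.congr_of_eventuallyEq ?_
    filter_upwards [Iio_mem_nhds hx] with y hy
    rw [min_eq_left (mem_Iio.1 hy).le]
  · subst hx
    rw [hasDerivAt_iff_isLittleO]
    simp only [min_self, mul_zero, smul_zero, sub_zero, ne_eq, OfNat.ofNat_ne_zero,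
      not_false_eq_true, zero_pow]
    have h : (fun y : ℝ => y ^ 2) =o[𝓝 0] fun y : ℝ => y := by
      simpa using Asymptotics.isLittleO_pow_pow (𝕜 := ℝ) one_lt_two
    refine Asymptotics.IsBigO.trans_isLittleO ?_ h
    refine Asymptotics.IsBigO.of_bound 1 (Eventually.of_forall fun y => ?_)
    rw [one_mul, norm_pow, norm_pow]
    gcongr
    rcases le_total y 0 with hy | hy <;> simp [hy]
  · rw [min_eq_right hx.le, mul_zero]
    refine (hasDerivAt_const x (0 : ℝ)).congr_of_eventuallyEq ?_
    filter_upwards [Ioi_mem_nhds hx] with y hy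
    rw [min_eq_right (mem_Ioi.1 hy).le]
    simp

/-- The closed quadrant is forward invariant under a planar linear system with nonnegative
off-diagonal coefficients (a cooperative system). -/
theorem nonneg_of_cooperative {a b : ℝ} {f₀ f₁ α₀ β₀ α₁ β₁ : ℝ → ℝ}
    (hα₀ : ContinuousOn α₀ (Icc a b)) (hβ₀ : ContinuousOn β₀ (Icc a b))
    (hα₁ : ContinuousOn α₁ (Icc a b)) (hβ₁ : ContinuousOn β₁ (Icc a b))
    (hf₀ : ∀ t ∈ Icc a b, HasDerivWithinAt f₀ (α₀ t * f₀ t + β₀ t * f₁ t) (Icc a b) t)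
    (hf₁ : ∀ t ∈ Icc a b, HasDerivWithinAt f₁ (α₁ t * f₁ t + β₁ t * f₀ t) (Icc a b) t)
    (hβ₀' : ∀ t ∈ Icc a b, 0 ≤ β₀ t) (hβ₁' : ∀ t ∈ Icc a b, 0 ≤ β₁ t)
    (h₀ : 0 ≤ f₀ a) (h₁ : 0 ≤ f₁ a) : ∀ t ∈ Icc a b, 0 ≤ f₀ t ∧ 0 ≤ f₁ t := by
  obtain ⟨A₀, hA₀⟩ := isCompact_Icc.exists_bound_of_continuousOn hα₀
  obtain ⟨B₀, hB₀⟩ := isCompact_Icc.exists_bound_of_continuousOn hβ₀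
  obtain ⟨A₁, hA₁⟩ := isCompact_Icc.exists_bound_of_continuousOn hα₁
  obtain ⟨B₁, hB₁⟩ := isCompact_Icc.exists_bound_of_continuousOn hβ₁
  set K : ℝ := 2 * (|A₀| + |B₀| + |A₁| + |B₁|) with hK
  set N : ℝ → ℝ := fun t => min (f₀ t) 0 ^ 2 + min (f₁ t) 0 ^ 2 with hN
  have hNd : ∀ t ∈ Icc a b, HasDerivWithinAt N
      (2 * min (f₀ t) 0 * (α₀ t * f₀ t + β₀ t * f₁ t)
        + 2 * min (f₁ t) 0 * (α₁ t * f₁ t + β₁ t * f₀ t)) (Icc a b) t := fun t ht =>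
    ((hasDerivAt_min_zero_sq (f₀ t)).comp_hasDerivWithinAt t (hf₀ t ht)).add
      ((hasDerivAt_min_zero_sq (f₁ t)).comp_hasDerivWithinAt t (hf₁ t ht))
  -- Writing `m` for the negative part, `2 m (α f + β g) ≤ 2 α m² + 2 β m m'` since `β m ≤ 0`.
  have hterm : ∀ {x y α β A B : ℝ}, 0 ≤ β → ‖α‖ ≤ A → ‖β‖ ≤ B →
      2 * min x 0 * (α * x + β * y) ≤
        (2 * |A| + |B|) * min x 0 ^ 2 + |B| * min y 0 ^ 2 := by
    intro x y α β A B hβ hα hβB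
    have e1 : min x 0 * x = min x 0 ^ 2 := by
      rcases le_total x 0 with h | h <;> simp [h, sq]
    have hm : min x 0 ≤ 0 := min_le_right _ _
    have hm' : min y 0 ≤ 0 := min_le_right _ _
    have hy : min y 0 ≤ y := min_le_left _ _
    have hαA : α ≤ |A| := (le_abs_self α).trans (hα.trans (le_abs_self A))
    have hβB' : β ≤ |B| := (le_abs_self β).trans (hβB.trans (le_abs_self B))
    have e2 : 2 * min x 0 * (α * x + β * y) = 2 * α * min x 0 ^ 2 + 2 * (β * (min x 0 * y)) := by
      rw [← e1]; ring
    have e3 : min x 0 * y ≤ min x 0 * min y 0 := mul_le_mul_of_nonpos_left hy hm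
    have e4 : 2 * (min x 0 * min y 0) ≤ min x 0 ^ 2 + min y 0 ^ 2 := by
      nlinarith [sq_nonneg (min x 0 - min y 0)]
    have e5 : 0 ≤ min x 0 * min y 0 := mul_nonneg_of_nonpos_of_nonpos hm hm'
    have e6 : β * (min x 0 * y) ≤ β * (min x 0 * min y 0) := mul_le_mul_of_nonneg_left e3 hβ
    have e7 : β * (min x 0 * min y 0) ≤ |B| * (min x 0 * min y 0) :=
      mul_le_mul_of_nonneg_right hβB' e5
    have e8 : |B| * (2 * (min x 0 * min y 0)) ≤ |B| * (min x 0 ^ 2 + min y 0 ^ 2) :=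
      mul_le_mul_of_nonneg_left e4 (abs_nonneg B)
    have e9 : α * min x 0 ^ 2 ≤ |A| * min x 0 ^ 2 :=
      mul_le_mul_of_nonneg_right hαA (sq_nonneg _)
    rw [e2]
    linarith
  have hexp : ∀ t, HasDerivAt (fun u : ℝ => Real.exp (-K * u)) (Real.exp (-K * t) * (-K)) t := by
    intro t
    simpa using ((hasDerivAt_id t).const_mul (-K)).exp
  have hanti : AntitoneOn (fun t => Real.exp (-K * t) * N t) (Icc a b) := by
    have hd := fun t ht => (hexp t).hasDerivWithinAt.mul (hNd t ht)
    refine antitoneOn_of_hasDerivWithinAt_nonpos (convex_Icc a b)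
      (HasDerivWithinAt.continuousOn hd)
      (fun t ht => (hd t (interior_subset ht)).mono interior_subset) ?_
    intro t ht
    have ht' := interior_subset ht
    have h1 := hterm (x := f₀ t) (y := f₁ t) (hβ₀' t ht') (hA₀ t ht') (hB₀ t ht')
    have h2 := hterm (x := f₁ t) (y := f₀ t) (hβ₁' t ht') (hA₁ t ht') (hB₁ t ht')
    have h3 := Real.exp_pos (-K * t)
    have h4 : 2 * min (f₀ t) 0 * (α₀ t * f₀ t + β₀ t * f₁ t)
        + 2 * min (f₁ t) 0 * (α₁ t * f₁ t + β₁ t * f₀ t) ≤ K * N t := by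
      simp only [hK, hN]
      nlinarith [mul_nonneg (abs_nonneg A₀) (sq_nonneg (min (f₁ t) 0)),
        mul_nonneg (abs_nonneg B₀) (sq_nonneg (min (f₁ t) 0)),
        mul_nonneg (abs_nonneg A₁) (sq_nonneg (min (f₀ t) 0)),
        mul_nonneg (abs_nonneg B₁) (sq_nonneg (min (f₀ t) 0)),
        mul_nonneg (abs_nonneg B₀) (sq_nonneg (min (f₀ t) 0)),
        mul_nonneg (abs_nonneg B₁) (sq_nonneg (min (f₁ t) 0))]
    nlinarith [mul_le_mul_of_nonneg_left h4 h3.le]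
  intro t ht
  have ha : a ∈ Icc a b := ⟨le_rfl, ht.1.trans ht.2⟩
  have h := hanti ha ht ht.1
  have hNa : N a = 0 := by simp [hN, h₀, h₁]
  have hNt : N t ≤ 0 := by
    simp only [hNa, mul_zero] at h
    exact nonpos_of_mul_nonpos_right h (Real.exp_pos _)
  have hz₀ : min (f₀ t) 0 ^ 2 = 0 := by
    have : min (f₀ t) 0 ^ 2 + min (f₁ t) 0 ^ 2 ≤ 0 := hNt
    nlinarith [sq_nonneg (min (f₀ t) 0), sq_nonneg (min (f₁ t) 0)]
  have hz₁ : min (f₁ t) 0 ^ 2 = 0 := by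
    have : min (f₀ t) 0 ^ 2 + min (f₁ t) 0 ^ 2 ≤ 0 := hNt
    nlinarith [sq_nonneg (min (f₀ t) 0), sq_nonneg (min (f₁ t) 0)]
  exact ⟨min_eq_right_iff.1 (pow_eq_zero_iff two_ne_zero |>.1 hz₀),
    min_eq_right_iff.1 (pow_eq_zero_iff two_ne_zero |>.1 hz₁)⟩

/-! ### The cone condition at a saddle point -/

/-- The cone condition at a saddle. Let `ra` and `rb` be linear coordinates that diagonalize the
derivative of `X` at `ξ`, with eigenvalues `l > 0 > m`. Along two solutions that converge to `ξ` in
backward time the difference `w` satisfies `|rb w| ≤ ε |ra w|` as long as both have stayed near `ξ`: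
near `ξ` the form `(rb w)² - ε² (ra w)²` is nonincreasing in time, and it tends to `0` at `-∞`. -/
theorem exists_cone_condition {V : Type*} [NormedAddCommGroup V] [NormedSpace ℝ V]
    {X : V → V} {J : V →L[ℝ] V} {ξ : V} (hX : HasStrictFDerivAt X J ξ) {ra rb : V →L[ℝ] ℝ}
    {l m : ℝ} (hl : 0 < l) (hm : m < 0) (hra : ∀ w, ra (J w) = l * ra w)
    (hrb : ∀ w, rb (J w) = m * rb w) {C : ℝ} (hC : ∀ w, ‖w‖ ≤ C * (|ra w| + |rb w|))
    {ε : ℝ} (hε : 0 < ε) :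
    ∃ U ∈ 𝓝 ξ, ∀ (Y Z : ℝ → V) (T : ℝ),
      (∀ t ≤ T, HasDerivAt Y (X (Y t)) t) → (∀ t ≤ T, HasDerivAt Z (X (Z t)) t) →
      (∀ t ≤ T, Y t ∈ U) → (∀ t ≤ T, Z t ∈ U) →
      Tendsto Y atBot (𝓝 ξ) → Tendsto Z atBot (𝓝 ξ) →
      |rb (Y T - Z T)| ≤ ε * |ra (Y T - Z T)| := by
  obtain ⟨κ, hκ, hκ1, hκ2⟩ : ∃ κ > 0, κ * (3 + ε ^ 2) ≤ -2 * m ∧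
      κ * (1 + 3 * ε ^ 2) ≤ 2 * ε ^ 2 * l := by
    refine ⟨min (-2 * m / (3 + ε ^ 2)) (2 * ε ^ 2 * l / (1 + 3 * ε ^ 2)), ?_, ?_, ?_⟩
    · have : 0 < -2 * m := by linarith
      exact lt_min (by positivity) (by positivity)
    · rw [← le_div_iff₀ (by positivity)]; exact min_le_left _ _
    · rw [← le_div_iff₀ (by positivity)]; exact min_le_right _ _
  set D : ℝ := (‖ra‖ + ‖rb‖ + 1) * (|C| + 1) with hD
  have hDpos : 0 < D := by positivity
  have hlo := hX.isLittleO.def (div_pos hκ hDpos)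
  rw [nhds_prod_eq, eventually_iff, mem_prod_same_iff] at hlo
  obtain ⟨U, hU, hUsub⟩ := hlo
  refine ⟨U, hU, fun Y Z T hY hZ hYU hZU hYl hZl => ?_⟩
  set w : ℝ → V := fun t => Y t - Z t with hw
  have hrem : ∀ t ≤ T, ‖X (Y t) - X (Z t) - J (w t)‖ ≤ κ / D * ‖w t‖ := fun t ht =>
    hUsub (mk_mem_prod (hYU t ht) (hZU t ht))
  have hbound : ∀ (r : V →L[ℝ] ℝ), ‖r‖ ≤ ‖ra‖ + ‖rb‖ + 1 → ∀ t ≤ T,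
      |r (X (Y t) - X (Z t) - J (w t))| ≤ κ * (|ra (w t)| + |rb (w t)|) := by
    intro r hr t ht
    have hs : 0 ≤ |ra (w t)| + |rb (w t)| := by positivity
    calc |r (X (Y t) - X (Z t) - J (w t))|
        ≤ ‖r‖ * ‖X (Y t) - X (Z t) - J (w t)‖ := r.le_opNorm _
      _ ≤ (‖ra‖ + ‖rb‖ + 1) * (κ / D * ((|C| + 1) * (|ra (w t)| + |rb (w t)|))) := by
          gcongr
          refine (hrem t ht).trans ?_
          gcongr
          refine (hC (w t)).trans ?_
          gcongr
          linarith [le_abs_self C]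
      _ = κ * (|ra (w t)| + |rb (w t)|) := by
          rw [hD]; field_simp
  have hdr : ∀ (r : V →L[ℝ] ℝ), ∀ t ≤ T,
      HasDerivAt (fun u => r (w u)) (r (X (Y t) - X (Z t))) t := fun r t ht =>
    r.hasFDerivAt.comp_hasDerivAt t ((hY t ht).sub (hZ t ht))
  set Q : ℝ → ℝ := fun t => rb (w t) ^ 2 - ε ^ 2 * ra (w t) ^ 2 with hQ
  have hQd : ∀ t ≤ T, HasDerivAt Q (2 * rb (w t) * rb (X (Y t) - X (Z t))
      - ε ^ 2 * (2 * ra (w t) * ra (X (Y t) - X (Z t)))) t := by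
    intro t ht
    have h1 := (hdr rb t ht).pow 2
    have h2 := ((hdr ra t ht).pow 2).const_mul (ε ^ 2)
    have h3 : HasDerivAt Q _ t := h1.sub h2
    exact h3.congr_deriv (by simp)
  have hanti : AntitoneOn Q (Iic T) := by
    refine antitoneOn_of_hasDerivWithinAt_nonpos (convex_Iic T)
      (HasDerivAt.continuousOn fun t ht => hQd t ht)
      (fun t ht => (hQd t (mem_Iic.1 (interior_subset ht))).hasDerivWithinAt) ?_
    intro t ht
    have ht' : t ≤ T := mem_Iic.1 (interior_subset ht)
    have ea : ra (X (Y t) - X (Z t)) = l * ra (w t) + ra (X (Y t) - X (Z t) - J (w t)) := by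
      rw [map_sub ra (_ - _), hra]; ring
    have eb : rb (X (Y t) - X (Z t)) = m * rb (w t) + rb (X (Y t) - X (Z t) - J (w t)) := by
      rw [map_sub rb (_ - _), hrb]; ring
    have ba := hbound ra (by linarith [norm_nonneg rb]) t ht'
    have bb := hbound rb (by linarith [norm_nonneg ra]) t ht'
    rw [ea, eb]
    generalize ra (X (Y t) - X (Z t) - J (w t)) = Ra at *
    generalize rb (X (Y t) - X (Z t) - J (w t)) = Rb at *
    generalize ra (w t) = A at *
    generalize rb (w t) = B at *
    have hA := sq_abs A
    have hB := sq_abs B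
    have h1 : B * Rb ≤ |B| * (κ * (|A| + |B|)) := by
      refine (le_abs_self _).trans ?_
      rw [abs_mul]; gcongr
    have h2 : -(A * Ra) ≤ |A| * (κ * (|A| + |B|)) := by
      refine (neg_le_abs _).trans ?_
      rw [abs_mul]; gcongr
    have h3 : 2 * (|A| * |B|) ≤ A ^ 2 + B ^ 2 := by
      nlinarith [sq_nonneg (|A| - |B|)]
    have h4 : 2 * (B * Rb) ≤ κ * (A ^ 2 + 3 * B ^ 2) := by
      nlinarith [mul_le_mul_of_nonneg_left h3 hκ.le]
    have h5 : 2 * -(A * Ra) ≤ κ * (3 * A ^ 2 + B ^ 2) := by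
      nlinarith [mul_le_mul_of_nonneg_left h3 hκ.le]
    have h6 := mul_le_mul_of_nonneg_left h5 (sq_nonneg ε)
    have h7 := mul_le_mul_of_nonneg_right hκ1 (sq_nonneg B)
    have h8 := mul_le_mul_of_nonneg_right hκ2 (sq_nonneg A)
    nlinarith
  have hwl : Tendsto w atBot (𝓝 0) := by simpa using hYl.sub hZl
  have hQl : Tendsto Q atBot (𝓝 0) := by
    have h1 : Tendsto (fun t => rb (w t)) atBot (𝓝 0) :=
      map_zero rb ▸ (rb.continuous.tendsto 0).comp hwl
    have h2 : Tendsto (fun t => ra (w t)) atBot (𝓝 0) :=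
      map_zero ra ▸ (ra.continuous.tendsto 0).comp hwl
    simpa using (h1.pow 2).sub ((h2.pow 2).const_mul (ε ^ 2))
  have hQT : Q T ≤ 0 := by
    refine ge_of_tendsto hQl ?_
    filter_upwards [eventually_le_atBot T] with t ht using hanti ht (mem_Iic.2 le_rfl) ht
  have : rb (w T) ^ 2 ≤ (ε * |ra (w T)|) ^ 2 := by
    rw [mul_pow, sq_abs]; linarith
  exact abs_le_of_sq_le_sq this (by positivity)

/-! ### Planar systems with concave quadratic rates -/

noncomputable section

/-- Coefficients of a planar system `Y_i' = -Y_i (a_i Y_i - b_i Y_i² - E(Y))` with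
`E(Y) = 1/2 + c₀ Y₀² + c₁ Y₁²`, all of them positive. -/
structure Coeffs where
  a : Fin 2 → ℝ
  b : Fin 2 → ℝ
  c : Fin 2 → ℝ
  a_pos : ∀ i, 0 < a i
  b_pos : ∀ i, 0 < b i
  c_pos : ∀ i, 0 < c i

namespace Coeffs

variable (S : Coeffs)

/-- The quadratic form with constant term `E(Y) = 1/2 + c₀ Y₀² + c₁ Y₁²` shared by both rates. -/
def energy (Y : Fin 2 → ℝ) : ℝ := 1 / 2 + S.c 0 * Y 0 ^ 2 + S.c 1 * Y 1 ^ 2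

/-- The rate `F_i(Y) = a_i Y_i - b_i Y_i² - E(Y)`, a strictly concave quadratic function. -/
def rate (i : Fin 2) (Y : Fin 2 → ℝ) : ℝ := S.a i * Y i - S.b i * Y i ^ 2 - S.energy Y

/-- The region where both rates are nonnegative, an intersection of two filled ellipses. -/
def region : Set (Fin 2 → ℝ) := {Y | ∀ i, 0 ≤ S.rate i Y}

/-- The vector field `(-Y₀ F₀(Y), -Y₁ F₁(Y))`. -/
def vf (Y : Fin 2 → ℝ) : Fin 2 → ℝ := fun i => -(Y i * S.rate i Y)

/-- The two properties of the coefficients on which the phase portrait depends: the region has an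
interior point, and it lies below the vertices of the parabolas `a_i y - b_i y²`, so that these are
strictly increasing in `y` there. -/
structure Admissible : Prop where
  exists_interior : ∃ m, ∀ i, 0 < S.rate i m
  two_b_mul_lt : ∀ Y ∈ S.region, ∀ i, 2 * S.b i * Y i < S.a i

variable {S}

/-! ### The region and its stationary points -/

theorem energy_pos (Y : Fin 2 → ℝ) : 0 < S.energy Y := by
  have h0 := mul_nonneg (S.c_pos 0).le (sq_nonneg (Y 0))
  have h1 := mul_nonneg (S.c_pos 1).le (sq_nonneg (Y 1))
  unfold energy; linarith

theorem pos_of_rate_nonneg {Y : Fin 2 → ℝ} {i : Fin 2} (h : 0 ≤ S.rate i Y) : 0 < Y i := by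
  have h1 := S.energy_pos Y
  have h2 := mul_nonneg (S.b_pos i).le (sq_nonneg (Y i))
  unfold rate at h
  exact pos_of_mul_pos_right (by linarith : 0 < S.a i * Y i) (S.a_pos i).le

theorem continuous_energy : Continuous S.energy := by
  unfold energy; fun_prop

theorem continuous_rate (i : Fin 2) : Continuous (S.rate i) := by
  have := S.continuous_energy
  unfold rate; fun_prop

theorem isClosed_region : IsClosed S.region := by
  rw [show S.region = ⋂ i, {Y | 0 ≤ S.rate i Y} by ext; simp [region]]
  exact isClosed_iInter fun i => isClosed_le continuous_const (S.continuous_rate i)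

theorem Admissible.isCompact_region (hS : S.Admissible) : IsCompact S.region := by
  refine isCompact_Icc (a := (0 : Fin 2 → ℝ)) (b := fun i => S.a i / (2 * S.b i))
    |>.of_isClosed_subset isClosed_region fun Y hY => ⟨fun i => ?_, fun i => ?_⟩
  · exact (pos_of_rate_nonneg (hY i)).le
  · have hb := S.b_pos i
    rw [le_div_iff₀ (by positivity)]
    linarith [hS.two_b_mul_lt Y hY i]

/-- Second-order Taylor expansion of the rates. -/
theorem rate_add (i : Fin 2) (Y w : Fin 2 → ℝ) : S.rate i (Y + w) = S.rate i Y +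
    ((S.a i - 2 * S.b i * Y i) * w i - 2 * S.c 0 * Y 0 * w 0 - 2 * S.c 1 * Y 1 * w 1) -
    (S.b i * w i ^ 2 + S.c 0 * w 0 ^ 2 + S.c 1 * w 1 ^ 2) := by
  simp only [rate, energy, Pi.add_apply]; ring

theorem convex_region : Convex ℝ S.region := by
  intro Y hY Z hZ s t hs ht hst i
  have key : S.rate i (s • Y + t • Z) = s * S.rate i Y + t * S.rate i Z + s * t *
      (S.b i * (Y i - Z i) ^ 2 + S.c 0 * (Y 0 - Z 0) ^ 2 + S.c 1 * (Y 1 - Z 1) ^ 2) := by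
    obtain rfl : t = 1 - s := by linarith
    simp only [rate, energy, Pi.add_apply, Pi.smul_apply, smul_eq_mul]; ring
  have hb := S.b_pos i
  have h0 := S.c_pos 0
  have h1 := S.c_pos 1
  have hYi := hY i
  have hZi := hZ i
  rw [key]
  positivity

theorem mem_region_of_rate_eq_zero {Y : Fin 2 → ℝ} (h : ∀ i, S.rate i Y = 0) : Y ∈ S.region :=
  fun i => (h i).ge

/-- At the larger of two ordered stationary points the Jacobian matrix of the rates has negative
determinant. Along the segment from the larger to the smaller point the rates vanish at both ends
and are concave, so both have positive derivative at its start. -/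
theorem saddle_of_lt (hS : S.Admissible) {P R : Fin 2 → ℝ} (hP : ∀ i, S.rate i P = 0)
    (hR : ∀ i, S.rate i R = 0) (hlt : ∀ i, P i < R i) :
    (S.a 0 - 2 * S.b 0 * R 0) * (S.a 1 - 2 * S.b 1 * R 1) <
      2 * S.c 0 * R 0 * (S.a 1 - 2 * S.b 1 * R 1) +
      2 * S.c 1 * R 1 * (S.a 0 - 2 * S.b 0 * R 0) := by
  have hmem := mem_region_of_rate_eq_zero hR
  have g := fun i => sub_pos.2 (hS.two_b_mul_lt R hmem i)
  have e := fun i => S.rate_add i R (P - R)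
  simp only [add_sub_cancel, hP, hR, Pi.sub_apply] at e
  have hs := fun i => mul_pos (mul_pos two_pos (S.c_pos i)) (pos_of_rate_nonneg (hmem i))
  have hq : ∀ i, (S.a i - 2 * S.b i * R i) * (R i - P i) <
      2 * S.c 0 * R 0 * (R 0 - P 0) + 2 * S.c 1 * R 1 * (R 1 - P 1) := by
    intro i
    have h0 := mul_nonneg (S.c_pos 0).le (sq_nonneg (P 0 - R 0))
    have h1 := mul_nonneg (S.c_pos 1).le (sq_nonneg (P 1 - R 1))
    have h2 := mul_pos (S.b_pos i) (pow_pos (sub_pos.2 (hlt i)) 2)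
    nlinarith [e i]
  have hk0 := sub_pos.2 (hlt 0)
  have hk1 := sub_pos.2 (hlt 1)
  have hq0 := hq 0
  have hq1 := hq 1
  have g0 := g 0
  have g1 := g 1
  have s0 := hs 0
  have s1 := hs 1
  generalize S.a 0 - 2 * S.b 0 * R 0 = x at *
  generalize S.a 1 - 2 * S.b 1 * R 1 = y at *
  generalize 2 * S.c 0 * R 0 = s at *
  generalize 2 * S.c 1 * R 1 = t at *
  generalize R 0 - P 0 = k at *
  generalize R 1 - P 1 = l at *
  have hT : 0 < s * k + t * l := by positivity
  have h1 := mul_lt_mul_of_pos_left hq0 (mul_pos s0 g1)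
  have h2 := mul_lt_mul_of_pos_left hq1 (mul_pos s1 g0)
  by_contra! h
  nlinarith [mul_le_mul_of_nonneg_right h hT.le]

/-- The larger of two ordered stationary points is maximal in the region. -/
theorem eq_of_le_of_lt (hS : S.Admissible) {P Q R : Fin 2 → ℝ} (hP : ∀ i, S.rate i P = 0)
    (hQ : ∀ i, S.rate i Q = 0) (hlt : ∀ i, P i < Q i) (hR : R ∈ S.region)
    (hle : ∀ i, Q i ≤ R i) : R = Q := by
  have hsad := saddle_of_lt hS hP hQ hlt
  have hmem := mem_region_of_rate_eq_zero hQ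
  have g := fun i => sub_pos.2 (hS.two_b_mul_lt Q hmem i)
  have hs := fun i => mul_pos (mul_pos two_pos (S.c_pos i)) (pos_of_rate_nonneg (hmem i))
  have e := fun i => S.rate_add i Q (R - Q)
  simp only [add_sub_cancel, hQ, Pi.sub_apply] at e
  have hq : ∀ i, 2 * S.c 0 * Q 0 * (R 0 - Q 0) + 2 * S.c 1 * Q 1 * (R 1 - Q 1) ≤
      (S.a i - 2 * S.b i * Q i) * (R i - Q i) := by
    intro i
    have h0 := mul_nonneg (S.c_pos 0).le (sq_nonneg (R 0 - Q 0))
    have h1 := mul_nonneg (S.c_pos 1).le (sq_nonneg (R 1 - Q 1))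
    have h2 := mul_nonneg (S.b_pos i).le (sq_nonneg (R i - Q i))
    linarith [e i, hR i]
  have hk0 := sub_nonneg.2 (hle 0)
  have hk1 := sub_nonneg.2 (hle 1)
  have hq0 := hq 0
  have hq1 := hq 1
  have g0 := g 0
  have g1 := g 1
  have s0 := hs 0
  have s1 := hs 1
  suffices h : R 0 - Q 0 = 0 ∧ R 1 - Q 1 = 0 by
    ext i; fin_cases i
    · exact sub_eq_zero.1 h.1
    · exact sub_eq_zero.1 h.2
  generalize S.a 0 - 2 * S.b 0 * Q 0 = x at *
  generalize S.a 1 - 2 * S.b 1 * Q 1 = y at *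
  generalize 2 * S.c 0 * Q 0 = s at *
  generalize 2 * S.c 1 * Q 1 = t at *
  generalize R 0 - Q 0 = k at *
  generalize R 1 - Q 1 = l at *
  have h1 := mul_le_mul_of_nonneg_left hq0 (mul_pos s0 g1).le
  have h2 := mul_le_mul_of_nonneg_left hq1 (mul_pos s1 g0).le
  have hT : s * k + t * l ≤ 0 := by
    by_contra! h
    nlinarith [mul_lt_mul_of_pos_right hsad h]
  have hsk : s * k = 0 := le_antisymm (by nlinarith) (by positivity)
  have htl : t * l = 0 := le_antisymm (by nlinarith) (by positivity)
  exact ⟨(mul_eq_zero.1 hsk).resolve_left s0.ne', (mul_eq_zero.1 htl).resolve_left s1.ne'⟩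

/-- Below the vertex, `a_i y - b_i y²` is strictly increasing. -/
theorem parabola_lt_iff {i : Fin 2} {y z : ℝ} (hy : 2 * S.b i * y < S.a i)
    (hz : 2 * S.b i * z < S.a i) :
    S.a i * y - S.b i * y ^ 2 < S.a i * z - S.b i * z ^ 2 ↔ y < z := by
  have h : S.a i * z - S.b i * z ^ 2 - (S.a i * y - S.b i * y ^ 2) =
      (S.a i - S.b i * (y + z)) * (z - y) := by ring
  have hp : 0 < S.a i - S.b i * (y + z) := by linarith
  rw [← sub_pos, h, mul_pos_iff_of_pos_left hp, sub_pos]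

/-- Any two stationary points are ordered in the same way in both coordinates, since
`a_i Y_i - b_i Y_i²` has the same value `E(Y)` for both `i`. -/
theorem lt_iff_lt (hS : S.Admissible) {P Q : Fin 2 → ℝ} (hP : ∀ i, S.rate i P = 0)
    (hQ : ∀ i, S.rate i Q = 0) (i j : Fin 2) : P i < Q i ↔ P j < Q j := by
  have h2 := hS.two_b_mul_lt P (mem_region_of_rate_eq_zero hP)
  have h3 := hS.two_b_mul_lt Q (mem_region_of_rate_eq_zero hQ)
  have hP' := fun i => sub_eq_zero.1 (hP i)
  have hQ' := fun i => sub_eq_zero.1 (hQ i)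
  rw [← parabola_lt_iff (h2 i) (h3 i), ← parabola_lt_iff (h2 j) (h3 j), hP', hP', hQ', hQ']

theorem eq_or_eq_of_rate_eq_zero (hS : S.Admissible) {P Q R : Fin 2 → ℝ}
    (hP : ∀ i, S.rate i P = 0) (hQ : ∀ i, S.rate i Q = 0) (hlt : ∀ i, P i < Q i)
    (hR : ∀ i, S.rate i R = 0) : R = Q ∨ R = P := by
  have heq : ∀ {A B : Fin 2 → ℝ}, (∀ i, S.rate i A = 0) → (∀ i, S.rate i B = 0) → A 0 = B 0 →
      A = B := by
    intro A B hA hB h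
    ext i
    have h1 := (lt_iff_lt hS hA hB 0 i).not
    have h2 := (lt_iff_lt hS hB hA 0 i).not
    rw [h] at h1 h2
    exact le_antisymm (not_lt.1 (h2.1 (lt_irrefl _))) (not_lt.1 (h1.1 (lt_irrefl _)))
  rcases lt_trichotomy (R 0) (P 0) with h | h | h
  · have hRP : ∀ i, R i < P i := fun i => (lt_iff_lt hS hR hP 0 i).1 h
    have := eq_of_le_of_lt hS hR hP hRP (mem_region_of_rate_eq_zero hQ) fun i => (hlt i).le
    exact absurd (congrFun this 0) (hlt 0).ne'
  · exact Or.inr (heq hR hP h)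
  rcases lt_trichotomy (R 0) (Q 0) with h' | h' | h'
  · have hPR : ∀ i, P i < R i := fun i => (lt_iff_lt hS hP hR 0 i).1 h
    have hRQ : ∀ i, R i < Q i := fun i => (lt_iff_lt hS hR hQ 0 i).1 h'
    have := eq_of_le_of_lt hS hP hR hPR (mem_region_of_rate_eq_zero hQ) fun i => (hRQ i).le
    exact absurd (congrFun this 0) (hRQ 0).ne'
  · exact Or.inl (heq hR hQ h')
  · have hQR : ∀ i, Q i < R i := fun i => (lt_iff_lt hS hQ hR 0 i).1 h'
    have := eq_of_le_of_lt hS hP hQ hlt (mem_region_of_rate_eq_zero hR) fun i => (hQR i).le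
    exact absurd (congrFun this 0) (hQR 0).ne'

/-- The smaller root `y` of `a_i y - b_i y² = e` in each coordinate, a curve parametrized by the
common value `e`. -/
def lowRoot (S : Coeffs) (e : ℝ) : Fin 2 → ℝ :=
  fun i => (S.a i - √(S.a i ^ 2 - 4 * S.b i * e)) / (2 * S.b i)

theorem rate_lowRoot {e : ℝ} {i : Fin 2} (he : 4 * S.b i * e ≤ S.a i ^ 2) :
    S.rate i (S.lowRoot e) = e - S.energy (S.lowRoot e) := by
  have hb := S.b_pos i
  have h := Real.sq_sqrt (sub_nonneg.2 he)
  have : S.a i * S.lowRoot e i - S.b i * S.lowRoot e i ^ 2 = e := by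
    unfold lowRoot
    field_simp
    nlinarith
  rw [rate, this]

theorem lowRoot_lt_lowRoot {e e' : ℝ} {i : Fin 2} (h : e < e') (he : 4 * S.b i * e' ≤ S.a i ^ 2) :
    S.lowRoot e i < S.lowRoot e' i := by
  have hb := S.b_pos i
  unfold lowRoot
  gcongr

theorem lowRoot_zero (i : Fin 2) : S.lowRoot 0 i = 0 := by
  simp [lowRoot, Real.sqrt_sq (S.a_pos i).le]

theorem lowRoot_parabola {i : Fin 2} {y : ℝ} (h : 2 * S.b i * y ≤ S.a i) :
    S.lowRoot (S.a i * y - S.b i * y ^ 2) i = y := by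
  have hb := S.b_pos i
  have : S.a i ^ 2 - 4 * S.b i * (S.a i * y - S.b i * y ^ 2) = (S.a i - 2 * S.b i * y) ^ 2 := by
    ring
  rw [lowRoot, this, Real.sqrt_sq (by linarith)]
  field_simp
  ring

/-- There are two ordered stationary points and no others. On the curve of smaller roots, the
stationary points are the zeros of `E - e`, which is positive at both ends of the curve and negative
at a point below an interior point of the region. -/
theorem exists_stationary_points (hS : S.Admissible) : ∃ ξ η : Fin 2 → ℝ,
    (∀ i, S.rate i ξ = 0) ∧ (∀ i, S.rate i η = 0) ∧ (∀ i, η i < ξ i) ∧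
      ∀ Y, (∀ i, S.rate i Y = 0) → Y = ξ ∨ Y = η := by
  obtain ⟨m, hm⟩ := hS.exists_interior
  have hmreg : m ∈ S.region := fun i => (hm i).le
  have hm2 := hS.two_b_mul_lt m hmreg
  have hmpos : ∀ i, 0 < m i := fun i => pos_of_rate_nonneg (hmreg i)
  set top : Fin 2 → ℝ := fun i => S.a i ^ 2 / (4 * S.b i) with htop
  set G : Fin 2 → ℝ := fun i => S.a i * m i - S.b i * m i ^ 2 with hG
  set h : ℝ → ℝ := fun e => S.energy (S.lowRoot e) - e with hh
  have hcont : Continuous h := by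
    have : Continuous S.lowRoot := by
      refine continuous_pi fun i => ?_
      unfold lowRoot; fun_prop
    exact (S.continuous_energy.comp this).sub continuous_id
  have hle_top : ∀ {e : ℝ} {i : Fin 2}, e ≤ top i → 4 * S.b i * e ≤ S.a i ^ 2 := by
    intro e i he
    have hb := S.b_pos i
    rw [htop, le_div_iff₀ (by positivity)] at he
    linarith
  have hG_top : ∀ i, G i < top i := by
    intro i
    have hb := S.b_pos i
    rw [htop, lt_div_iff₀ (by positivity)]
    have := pow_pos (sub_pos.2 (hm2 i)) 2
    simp only [hG]
    nlinarith
  set e₀ : ℝ := min (G 0) (G 1) with he₀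
  set e₁ : ℝ := min (top 0) (top 1) with he₁
  have he₀G : ∀ i, e₀ ≤ G i := Fin.forall_fin_two.2 ⟨min_le_left _ _, min_le_right _ _⟩
  have he₁top : ∀ i, e₁ ≤ top i := Fin.forall_fin_two.2 ⟨min_le_left _ _, min_le_right _ _⟩
  have hGE : ∀ i, S.energy m < G i := fun i => sub_pos.1 (hm i)
  have hEe₀ : S.energy m < e₀ := lt_min (hGE 0) (hGE 1)
  have he₀pos : 0 < e₀ := (S.energy_pos m).trans hEe₀
  have he₀₁ : e₀ < e₁ := min_lt_min (hG_top 0) (hG_top 1)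
  have hstart : 0 < h 0 := by simpa [hh] using S.energy_pos _
  have hmid : h e₀ < 0 := by
    have hle : ∀ i, S.lowRoot e₀ i ≤ m i := by
      intro i
      rw [← lowRoot_parabola (hm2 i).le]
      rcases (he₀G i).lt_or_eq with h' | h'
      · exact (lowRoot_lt_lowRoot h' (hle_top (hG_top i).le)).le
      · rw [h']
    have hnn : ∀ i, 0 ≤ S.lowRoot e₀ i := fun i => by
      rw [← lowRoot_zero (S := S) i]
      exact (lowRoot_lt_lowRoot he₀pos (hle_top (he₀₁.le.trans (he₁top i)))).le
    have : S.energy (S.lowRoot e₀) ≤ S.energy m := by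
      have c0 := (S.c_pos 0).le
      have c1 := (S.c_pos 1).le
      have n0 := hnn 0
      have n1 := hnn 1
      have l0 := hle 0
      have l1 := hle 1
      unfold energy
      gcongr
    simp only [hh]; linarith
  have hend : 0 < h e₁ := by
    by_contra! hneg
    have hreg : S.lowRoot e₁ ∈ S.region := fun i => by
      rw [rate_lowRoot (hle_top (he₁top i))]
      simp only [hh] at hneg; linarith
    -- At the end of the curve one of the coordinates is at the vertex of its parabola.
    have hvertex : ∀ i, e₁ = top i → False := by
      intro i hi
      have hb := S.b_pos i
      have h1 := hS.two_b_mul_lt _ hreg i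
      have h2 : S.lowRoot e₁ i = S.a i / (2 * S.b i) := by
        have : S.a i ^ 2 - 4 * S.b i * e₁ = 0 := by
          rw [hi, htop]; field_simp; ring
        rw [lowRoot, this, Real.sqrt_zero, sub_zero]
      rw [h2, mul_div_cancel₀ _ (by positivity)] at h1
      exact lt_irrefl _ h1
    rcases min_choice (top 0) (top 1) with h' | h'
    · exact hvertex 0 h'
    · exact hvertex 1 h'
  obtain ⟨e, he, hez⟩ := intermediate_value_Icc' he₀pos.le hcont.continuousOn
    (show (0 : ℝ) ∈ Icc (h e₀) (h 0) from ⟨hmid.le, hstart.le⟩)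
  obtain ⟨e', he', hez'⟩ := intermediate_value_Icc he₀₁.le hcont.continuousOn
    (show (0 : ℝ) ∈ Icc (h e₀) (h e₁) from ⟨hmid.le, hend.le⟩)
  have hlt : e < e' := by
    refine (he.2.lt_of_ne ?_).trans_le he'.1
    rintro rfl
    exact hmid.ne hez
  have hstat : ∀ {x : ℝ}, x ≤ e₁ → h x = 0 → ∀ i, S.rate i (S.lowRoot x) = 0 := by
    intro x hx hz i
    rw [rate_lowRoot (hle_top (hx.trans (he₁top i)))]
    simp only [hh] at hz; linarith
  have hξ := hstat he'.2 hez'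
  have hη := hstat (he.2.trans he₀₁.le) hez
  have hlt' : ∀ i, S.lowRoot e i < S.lowRoot e' i := fun i =>
    lowRoot_lt_lowRoot hlt (hle_top (he'.2.trans (he₁top i)))
  exact ⟨_, _, hξ, hη, hlt', fun Y hY => eq_or_eq_of_rate_eq_zero hS hη hξ hlt' hY⟩


/-! ### Invariance of the region and limits of solutions -/

theorem contDiff_vf {k : WithTop ℕ∞} : ContDiff ℝ k S.vf := by
  refine contDiff_pi.2 fun i => ?_
  unfold vf rate energy
  fun_prop

theorem vf_eq_zero {Y : Fin 2 → ℝ} (h : ∀ i, S.rate i Y = 0) : S.vf Y = 0 := by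
  ext i; simp [vf, h]

theorem hasDerivWithinAt_rate {Y : ℝ → Fin 2 → ℝ} {d : Fin 2 → ℝ} {s : Set ℝ} {t : ℝ}
    (hY : HasDerivWithinAt Y d s t) (i : Fin 2) :
    HasDerivWithinAt (fun u => S.rate i (Y u)) ((S.a i - 2 * S.b i * Y t i) * d i
      - 2 * S.c 0 * Y t 0 * d 0 - 2 * S.c 1 * Y t 1 * d 1) s t := by
  have h := hasDerivWithinAt_pi.1 hY
  have he := ((((h 0).pow 2).const_mul (S.c 0)).const_add (1 / 2)).add
    (((h 1).pow 2).const_mul (S.c 1))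
  have hr := (((h i).const_mul (S.a i)).sub (((h i).pow 2).const_mul (S.b i))).sub he
  refine HasDerivWithinAt.congr_deriv (f' := _) hr ?_
  simp only [Nat.cast_ofNat]
  ring

/-- The sets where both rates are nonnegative, and where both are nonpositive, are forward invariant
under the vector field, even if it is run at a variable nonnegative speed `χ`: along a solution the
rates satisfy a cooperative linear system. -/
theorem mul_rate_nonneg {Y : ℝ → Fin 2 → ℝ} {χ : ℝ → ℝ} {a b : ℝ}
    (hY : ∀ t ∈ Icc a b, HasDerivWithinAt Y (χ t • S.vf (Y t)) (Icc a b) t)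
    (hχ : ContinuousOn χ (Icc a b)) (hχ' : ∀ t ∈ Icc a b, 0 ≤ χ t) (σ : ℝ)
    (h : ∀ i, 0 ≤ σ * S.rate i (Y a)) : ∀ t ∈ Icc a b, ∀ i, 0 ≤ σ * S.rate i (Y t) := by
  have hc := fun i => continuousOn_pi.1 (HasDerivWithinAt.continuousOn hY) i
  have hc0 := hc 0
  have hc1 := hc 1
  have c0 := S.c_pos 0
  have c1 := S.c_pos 1
  intro t ht
  refine Fin.forall_fin_two.2 (nonneg_of_cooperative
    (f₀ := fun t => σ * S.rate 0 (Y t)) (f₁ := fun t => σ * S.rate 1 (Y t))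
    (α₀ := fun t => χ t * (2 * S.c 0 * Y t 0 ^ 2 - (S.a 0 - 2 * S.b 0 * Y t 0) * Y t 0))
    (β₀ := fun t => χ t * (2 * S.c 1 * Y t 1 ^ 2))
    (α₁ := fun t => χ t * (2 * S.c 1 * Y t 1 ^ 2 - (S.a 1 - 2 * S.b 1 * Y t 1) * Y t 1))
    (β₁ := fun t => χ t * (2 * S.c 0 * Y t 0 ^ 2))
    (by fun_prop) (by fun_prop) (by fun_prop) (by fun_prop) ?_ ?_ ?_ ?_ (h 0) (h 1) t ht)
  · intro t ht
    refine ((hasDerivWithinAt_rate (hY t ht) 0).const_mul σ).congr_deriv ?_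
    simp only [vf, Pi.smul_apply, smul_eq_mul]; ring
  · intro t ht
    refine ((hasDerivWithinAt_rate (hY t ht) 1).const_mul σ).congr_deriv ?_
    simp only [vf, Pi.smul_apply, smul_eq_mul]; ring
  · intro t ht
    have := hχ' t ht
    positivity
  · intro t ht
    have := hχ' t ht
    positivity

/-- Inside the region solutions are monotone in both coordinates, so they converge, forward in time
(`σ = 1`) or backward in time (`σ = -1`), and the limit is a stationary point. -/
theorem exists_tendsto_of_mem_region (hS : S.Admissible) {Y : ℝ → Fin 2 → ℝ} {a σ : ℝ} (hσ : σ ≠ 0)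
    (hY : ∀ t ∈ Ici a, HasDerivWithinAt Y (σ • S.vf (Y t)) (Ici a) t)
    (hmem : ∀ t ∈ Ici a, Y t ∈ S.region) :
    ∃ L, Tendsto Y atTop (𝓝 L) ∧ (∀ i, S.rate i L = 0) ∧ ∀ i, 0 ≤ σ * (Y a i - L i) := by
  have hd := fun t ht => hasDerivWithinAt_pi.1 (hY t ht)
  have hanti : ∀ i, AntitoneOn (fun t => σ * Y t i) (Ici a) := by
    intro i
    have hd' := fun t ht => ((hd t ht) i).const_mul σ
    refine antitoneOn_of_hasDerivWithinAt_nonpos (convex_Ici a)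
      (HasDerivWithinAt.continuousOn hd')
      (fun t ht => (hd' t (interior_subset ht)).mono interior_subset) ?_
    intro t ht
    have hr := hmem t (interior_subset ht) i
    have := mul_nonneg (mul_self_nonneg σ) (mul_nonneg (pos_of_rate_nonneg hr).le hr)
    simp only [vf, Pi.smul_apply, smul_eq_mul]
    linarith
  obtain ⟨R, hR⟩ := hS.isCompact_region.isBounded.exists_norm_le
  have hlim : ∀ i, ∃ l, Tendsto (fun t => σ * Y t i) atTop (𝓝 l) := by
    intro i
    have hanti' : Antitone fun t => σ * Y (max t a) i := fun s t hst =>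
      hanti i (mem_Ici.2 (le_max_right _ _)) (mem_Ici.2 (le_max_right _ _)) (max_le_max_right a hst)
    have hbdd : BddBelow (range fun t => σ * Y (max t a) i) := by
      refine ⟨-(|σ| * R), ?_⟩
      rintro _ ⟨t, rfl⟩
      refine neg_le_of_abs_le ?_
      rw [abs_mul]
      gcongr
      exact (norm_le_pi_norm (Y (max t a)) i).trans (hR _ (hmem _ (mem_Ici.2 (le_max_right _ _))))
    refine ⟨_, (tendsto_atTop_ciInf hanti' hbdd).congr' ?_⟩
    filter_upwards [eventually_ge_atTop a] with t ht
    rw [max_eq_left ht]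
  choose l hl using hlim
  have hlim' : Tendsto Y atTop (𝓝 fun i => σ⁻¹ * l i) := by
    refine tendsto_pi_nhds.2 fun i => ?_
    simpa [hσ] using (hl i).const_mul σ⁻¹
  set L : Fin 2 → ℝ := fun i => σ⁻¹ * l i with hL
  have hLmem : L ∈ S.region := isClosed_region.mem_of_tendsto hlim'
    ((eventually_ge_atTop a).mono hmem)
  refine ⟨L, hlim', fun i => ?_, fun i => ?_⟩
  · have hvf : Tendsto (fun t => (σ • S.vf (Y t)) i) atTop (𝓝 ((σ • S.vf L) i)) :=
      ((((contDiff_vf (k := 0)).continuous.tendsto L).comp hlim').const_smul σ).apply_nhds i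
    have hzero := eq_zero_of_tendsto_of_tendsto_deriv (a := a)
      (fun t ht => ((hd t ht.le) i).hasDerivAt (Ici_mem_nhds ht)) (hlim'.apply_nhds i) hvf
    have hpos := pos_of_rate_nonneg (hLmem i)
    simpa [vf, hσ, hpos.ne'] using hzero
  · have : σ * L i ≤ σ * Y a i := by
      refine le_of_tendsto ((hlim'.apply_nhds i).const_mul σ) ?_
      filter_upwards [eventually_ge_atTop a] with t ht
      exact hanti i self_mem_Ici ht ht
    linarith

/-- A bounded Lipschitz vector field that agrees with `S.vf` on the region and leaves it
forward invariant. It is the product of `S.vf` and a bump function. -/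
theorem exists_cutoff (hS : S.Admissible) : ∃ (X : (Fin 2 → ℝ) → Fin 2 → ℝ) (K M : ℝ≥0),
    LipschitzWith K X ∧ (∀ Y, ‖X Y‖ ≤ M) ∧ (∀ Y ∈ S.region, X Y = S.vf Y) ∧
    ∀ (Y : ℝ → Fin 2 → ℝ) (a b : ℝ), (∀ t, HasDerivAt Y (X (Y t)) t) → a ≤ b →
      Y a ∈ S.region → Y b ∈ S.region := by
  obtain ⟨R, hRpos, hR⟩ := hS.isCompact_region.isBounded.exists_pos_norm_le
  let ρ : ContDiffBump (0 : Fin 2 → ℝ) := ⟨R, R + 1, hRpos, lt_add_one R⟩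
  have hρ : ContDiff ℝ 1 ρ := ρ.contDiff
  have hX : ContDiff ℝ 1 fun Y => ρ Y • S.vf Y := hρ.smul contDiff_vf
  have hsupp : HasCompactSupport fun Y => ρ Y • S.vf Y := ρ.hasCompactSupport.smul_right
  obtain ⟨K, hK⟩ := ContDiff.lipschitzWith_of_hasCompactSupport hsupp hX one_ne_zero
  obtain ⟨M, hM⟩ := hsupp.exists_bound_of_continuous hX.continuous
  refine ⟨_, K, M.toNNReal, hK, fun Y => (hM Y).trans (Real.le_coe_toNNReal M), fun Y hY => ?_,
    fun Y a b hY hab ha i => ?_⟩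
  · rw [ρ.one_of_mem_closedBall (by simpa using hR Y hY), one_smul]
  · have hYc : Continuous Y := continuous_iff_continuousAt.2 fun t => (hY t).continuousAt
    have := mul_rate_nonneg (χ := fun t => ρ (Y t)) (fun t _ => (hY t).hasDerivWithinAt)
      (hρ.continuous.comp hYc).continuousOn (fun t _ => ρ.nonneg) 1
      (fun i => by simpa using ha i) b ⟨hab, le_rfl⟩ i
    simpa using this

theorem exists_forward_solution (hS : S.Admissible) {p : Fin 2 → ℝ} (hp : p ∈ S.region) :
    ∃ Y : ℝ → Fin 2 → ℝ, Y 0 = p ∧ ∀ t ∈ Ici (0 : ℝ), HasDerivWithinAt Y (S.vf (Y t)) (Ici 0) t := by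
  obtain ⟨X, K, M, hK, hM, hXvf, hinv⟩ := exists_cutoff hS
  obtain ⟨Φ, h0, hΦ, -⟩ := exists_global_flow hK hM
  refine ⟨fun t => Φ t p, h0 p, fun t ht => ?_⟩
  have := hinv (fun t => Φ t p) 0 t (hΦ p) ht (by simpa [h0] using hp)
  rw [← hXvf _ this]
  exact (hΦ p t).hasDerivWithinAt

/-- A solution in the region tends to the lower stationary point `η`, unless it starts at the
maximal point `ξ`. -/
theorem tendsto_of_mem_region (hS : S.Admissible) {ξ η : Fin 2 → ℝ} (hξ : ∀ i, S.rate i ξ = 0)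
    (hη : ∀ i, S.rate i η = 0) (hlt : ∀ i, η i < ξ i) {Y : ℝ → Fin 2 → ℝ}
    (hY : ∀ t ∈ Ici (0 : ℝ), HasDerivWithinAt Y (S.vf (Y t)) (Ici 0) t) (h0 : Y 0 ∈ S.region)
    (hne : Y 0 ≠ ξ) : Tendsto Y atTop (𝓝 η) := by
  have hmem : ∀ t ∈ Ici (0 : ℝ), Y t ∈ S.region := by
    intro t ht i
    have := mul_rate_nonneg (S := S) (Y := Y) (χ := fun _ => 1) (a := 0) (b := t)
      (fun u hu => by simpa using (hY u hu.1).mono Icc_subset_Ici_self)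
      continuousOn_const (fun _ _ => zero_le_one) 1 (fun i => by simpa using h0 i) t ⟨ht, le_rfl⟩ i
    simpa using this
  obtain ⟨L, hL, hL0, hle⟩ := exists_tendsto_of_mem_region hS one_ne_zero
    (fun t ht => by simpa using hY t ht) hmem
  rcases eq_or_eq_of_rate_eq_zero hS hη hξ hlt hL0 with rfl | rfl
  · exact absurd (eq_of_le_of_lt hS hη hξ hlt h0 fun i => by simpa using hle i) hne
  · exact hL

/-- A solution that stays in the region for all times and connects `ξ` to `η`. The images of the
region under the flow form a decreasing sequence of compact sets; each of them contains a path from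
`η` to `ξ` and therefore meets the line `Y₀ = (ξ₀ + η₀) / 2`. A point of this line in all the
images has a backward orbit in the region. -/
theorem exists_connecting_solution (hS : S.Admissible) {ξ η : Fin 2 → ℝ}
    (hξ : ∀ i, S.rate i ξ = 0) (hη : ∀ i, S.rate i η = 0) (hlt : ∀ i, η i < ξ i) :
    ∃ Y : ℝ → Fin 2 → ℝ, (∀ t, HasDerivAt Y (S.vf (Y t)) t) ∧ Y 0 ∈ S.region ∧ Y 0 ≠ ξ ∧
      Tendsto Y atBot (𝓝 ξ) := by
  obtain ⟨X, K, M, hK, hM, hXvf, hinv⟩ := exists_cutoff hS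
  obtain ⟨Φ, h0, hΦ, hΦc⟩ := exists_global_flow hK hM
  have huniq : ∀ {y z : ℝ → Fin 2 → ℝ}, (∀ t, HasDerivAt y (X (y t)) t) →
      (∀ t, HasDerivAt z (X (z t)) t) → ∀ {t₀}, y t₀ = z t₀ → y = z := fun hy hz _ h =>
    ODE_solution_unique_univ (v := fun _ => X) (s := fun _ => univ)
      (fun _ => hK.lipschitzOnWith) (fun t => ⟨hy t, trivial⟩) (fun t => ⟨hz t, trivial⟩) h
  have hshift : ∀ p c t, HasDerivAt (fun u => Φ (u + c) p) (X (Φ (t + c) p)) t := fun p c t =>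
    (hΦ p (t + c)).comp_add_const t c
  have hadd : ∀ s t p, Φ (s + t) p = Φ s (Φ t p) := fun s t p =>
    congrFun (huniq (hshift p t) (hΦ (Φ t p)) (t₀ := 0) (by simp [h0])) s
  have hfix : ∀ {p}, (∀ i, S.rate i p = 0) → ∀ t, Φ t p = p := fun {p} hp t =>
    congrFun (huniq (hΦ p) (z := fun _ => p) (fun t => by
      rw [hXvf p (mem_region_of_rate_eq_zero hp), vf_eq_zero hp]
      exact hasDerivAt_const t p) (t₀ := 0) (h0 p)) t
  have hfwd : ∀ {p}, p ∈ S.region → ∀ {t}, 0 ≤ t → Φ t p ∈ S.region := fun {p} hp {t} ht =>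
    hinv (fun t => Φ t p) 0 t (hΦ p) ht (by simpa [h0] using hp)
  have hξm := mem_region_of_rate_eq_zero hξ
  have hηm := mem_region_of_rate_eq_zero hη
  set mid : ℝ := (ξ 0 + η 0) / 2 with hmid
  let T : ℕ → Set (Fin 2 → ℝ) := fun k => Φ k '' S.region ∩ {p | p 0 = mid}
  have hTc : ∀ k, IsCompact (T k) := fun k =>
    (hS.isCompact_region.image (hΦc k k.cast_nonneg)).inter_right
      (isClosed_eq (continuous_apply 0) continuous_const)
  have hTanti : ∀ k, T (k + 1) ⊆ T k := by
    rintro k _ ⟨⟨y, hy, rfl⟩, hp⟩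
    refine ⟨⟨Φ 1 y, hfwd hy zero_le_one, ?_⟩, hp⟩
    rw [← hadd]; push_cast; rfl
  have hTne : ∀ k, (T k).Nonempty := by
    intro k
    have hpre : IsPreconnected (Φ k '' S.region) :=
      convex_region.isPreconnected.image _ (hΦc k k.cast_nonneg).continuousOn
    obtain ⟨p, hp, hp0⟩ := hpre.intermediate_value (f := fun p => p 0)
      ⟨η, hηm, hfix hη k⟩ ⟨ξ, hξm, hfix hξ k⟩ (continuous_apply 0).continuousOn
      (show mid ∈ Icc (η 0) (ξ 0) by constructor <;> linarith [hlt 0])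
    exact ⟨p, hp, hp0⟩
  obtain ⟨p, hp⟩ := IsCompact.nonempty_iInter_of_sequence_nonempty_isCompact_isClosed T hTanti hTne
    (hTc 0) fun k => (hTc k).isClosed
  have hp' := mem_iInter.1 hp
  have hpmid : p 0 = mid := (hp' 0).2
  have hmem : ∀ t, Φ t p ∈ S.region := by
    intro t
    obtain ⟨k, hk⟩ := exists_nat_ge (-t)
    obtain ⟨y, hy, hyp⟩ := (hp' k).1
    rw [← hyp, ← hadd]
    exact hfwd hy (by linarith)
  have hvf : ∀ t, HasDerivAt (fun u => Φ u p) (S.vf (Φ t p)) t := fun t => by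
    rw [← hXvf _ (hmem t)]; exact hΦ p t
  refine ⟨fun t => Φ t p, hvf, hmem 0, ?_, ?_⟩
  · intro h
    have hpξ : p = ξ := (h0 p).symm.trans h
    rw [hpξ] at hpmid
    linarith [hlt 0]
  have hrev : ∀ t, HasDerivAt (fun u => Φ (-u) p) ((-1 : ℝ) • S.vf (Φ (-t) p)) t := fun t => by
    exact (hvf (-t)).scomp t (hasDerivAt_neg t)
  obtain ⟨L, hL, hL0, hle⟩ := exists_tendsto_of_mem_region hS (a := 0) (σ := -1) (by norm_num)
    (fun t _ => (hrev t).hasDerivWithinAt) fun t _ => hmem (-t)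
  have hLξ : L = ξ := by
    refine (eq_or_eq_of_rate_eq_zero hS hη hξ hlt hL0).resolve_right ?_
    rintro rfl
    have := hle 0
    simp only [neg_zero, h0] at this
    linarith [hlt 0]
  subst hLξ
  simpa [Function.comp_def] using hL.comp tendsto_neg_atBot_atTop


/-! ### The linearization at the saddle point -/

theorem fderiv_vf_apply (Y w : Fin 2 → ℝ) (i : Fin 2) :
    fderiv ℝ S.vf Y w i = -(w i * S.rate i Y + Y i *
      ((S.a i - 2 * S.b i * Y i) * w i - 2 * S.c 0 * Y 0 * w 0 - 2 * S.c 1 * Y 1 * w 1)) := by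
  have hline : HasDerivAt (fun t : ℝ => Y + t • w) w 0 := by
    simpa using ((hasDerivAt_id (0 : ℝ)).smul_const w).const_add Y
  have hd : HasFDerivAt S.vf (fderiv ℝ S.vf Y) (Y + (0 : ℝ) • w) := by
    rw [zero_smul, add_zero]
    exact (contDiff_vf (k := 1)).differentiable one_ne_zero |>.differentiableAt.hasFDerivAt
  have h1 := hasDerivAt_pi.1 (hd.comp_hasDerivAt 0 hline) i
  have h2 := hasDerivWithinAt_univ.1
    (((hasDerivWithinAt_pi.1 hline.hasDerivWithinAt i).mul
      (hasDerivWithinAt_rate (S := S) (hline.hasDerivWithinAt (s := univ)) i)).neg)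
  have h3 := h1.unique h2
  simpa using h3

/-- The characteristic polynomial of a real `2 × 2` matrix with negative determinant has one positive
and one negative root. -/
theorem exists_roots_of_det_neg {A B C D : ℝ} (hdet : A * D < B * C) :
    ∃ l m : ℝ, 0 < l ∧ m < 0 ∧ l + m = A + D ∧ l * m = A * D - B * C := by
  have hlt : (A + D) ^ 2 < (A + D) ^ 2 - 4 * (A * D - B * C) := by linarith
  have hs := Real.sq_sqrt ((sq_nonneg (A + D)).trans hlt.le)
  have habs : |A + D| < √((A + D) ^ 2 - 4 * (A * D - B * C)) := by
    rw [← Real.sqrt_sq_eq_abs]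
    exact Real.sqrt_lt_sqrt (sq_nonneg _) hlt
  refine ⟨(A + D + √((A + D) ^ 2 - 4 * (A * D - B * C))) / 2,
    (A + D - √((A + D) ^ 2 - 4 * (A * D - B * C))) / 2, ?_, ?_, by ring, by linarith⟩
  · linarith [(abs_lt.1 habs).1]
  · linarith [(abs_lt.1 habs).2]

/-- A planar linear map `J` with positive off-diagonal entries and negative determinant has
eigenvalues `l > 0 > m`. The functionals `ra` and `rb` are its left eigenvectors. The eigenvector for
`l` has positive coordinates, and so has `J w` for all `w` close to its direction. -/
theorem exists_left_eigenvectors {J : (Fin 2 → ℝ) →L[ℝ] (Fin 2 → ℝ)} {A B C D : ℝ}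
    (hJ0 : ∀ w, J w 0 = A * w 0 + B * w 1) (hJ1 : ∀ w, J w 1 = C * w 0 + D * w 1)
    (hB : 0 < B) (hC : 0 < C) (hdet : A * D < B * C) :
    ∃ (l m : ℝ) (ra rb : (Fin 2 → ℝ) →L[ℝ] ℝ) (κ ε : ℝ), 0 < l ∧ m < 0 ∧
      (∀ w, ra (J w) = l * ra w) ∧ (∀ w, rb (J w) = m * rb w) ∧
      (∀ w, ‖w‖ ≤ κ * (|ra w| + |rb w|)) ∧ 0 < ε ∧
      ∀ w, 0 < ra w → |rb w| ≤ ε * |ra w| → ∀ i, 0 < J w i := by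
  obtain ⟨l, m, hl, hm, hsum, hprod⟩ := exists_roots_of_det_neg hdet
  have hlm : (l - A) * (A - m) = B * C := by
    linear_combination (-1) * hprod + A * hsum
  have hBC : 0 < B * C := mul_pos hB hC
  have hlA : 0 < l - A := by
    by_contra! h
    nlinarith [mul_nonneg_of_nonpos_of_nonpos h (by linarith : m - A ≤ 0)]
  have hAm : 0 < A - m := by
    by_contra! h
    nlinarith
  have hlm' : 0 < l - m := by linarith
  let ra : (Fin 2 → ℝ) →L[ℝ] ℝ :=
    C • ContinuousLinearMap.proj 0 + (l - A) • ContinuousLinearMap.proj 1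
  let rb : (Fin 2 → ℝ) →L[ℝ] ℝ :=
    C • ContinuousLinearMap.proj 0 + (m - A) • ContinuousLinearMap.proj 1
  have hra : ∀ w, ra w = C * w 0 + (l - A) * w 1 := fun w => rfl
  have hrb : ∀ w, rb w = C * w 0 + (m - A) * w 1 := fun w => rfl
  have hraJ : ∀ w, ra (J w) = l * ra w := by
    intro w
    rw [hra, hra, hJ0, hJ1]
    linear_combination w 1 * (-1 * hlm - (l - A) * hsum)
  have hrbJ : ∀ w, rb (J w) = m * rb w := by
    intro w
    rw [hrb, hrb, hJ0, hJ1]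
    linear_combination w 1 * (-1 * hlm - (m - A) * hsum)
  -- The coordinates of `w` in terms of `ra w` and `rb w`.
  have hw1 : ∀ w, (l - m) * w 1 = ra w - rb w := by
    intro w; rw [hra, hrb]; ring
  have hw0 : ∀ w, C * (l - m) * w 0 = (A - m) * ra w + (l - A) * rb w := by
    intro w; rw [hra, hrb]; ring
  refine ⟨l, m, ra, rb, 1 / (l - m) + 1 / C, min (l / -m / 2) (l / -m * ((A - m) / (2 * (l - A)))),
    hl, hm, hraJ, hrbJ, fun w => ?_, ?_, fun w hpos hle => ?_⟩
  · have hb0 : |w 0| ≤ 1 / C * (|ra w| + |rb w|) := by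
      rw [one_div, ← div_eq_inv_mul, le_div_iff₀ hC]
      refine le_of_mul_le_mul_left ?_ hlm'
      calc (l - m) * (|w 0| * C) = |C * (l - m) * w 0| := by
            rw [abs_mul, abs_of_pos (mul_pos hC hlm')]; ring
        _ ≤ (A - m) * |ra w| + (l - A) * |rb w| := by
            rw [hw0]
            refine (abs_add_le _ _).trans ?_
            rw [abs_mul, abs_mul, abs_of_pos hAm, abs_of_pos hlA]
        _ ≤ (l - m) * (|ra w| + |rb w|) := by
            nlinarith [abs_nonneg (ra w), abs_nonneg (rb w)]
    have hb1 : |w 1| ≤ 1 / (l - m) * (|ra w| + |rb w|) := by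
      rw [one_div, ← div_eq_inv_mul, le_div_iff₀ hlm']
      calc |w 1| * (l - m) = |(l - m) * w 1| := by rw [abs_mul, abs_of_pos hlm', mul_comm]
        _ ≤ |ra w| + |rb w| := by rw [hw1]; exact abs_sub _ _
    have hs : 0 ≤ |ra w| + |rb w| := by positivity
    have hp0 : 0 ≤ 1 / C * (|ra w| + |rb w|) := by positivity
    have hp1 : 0 ≤ 1 / (l - m) * (|ra w| + |rb w|) := by positivity
    rw [pi_norm_le_iff_of_nonneg (by rw [add_mul]; positivity)]
    refine Fin.forall_fin_two.2 ⟨?_, ?_⟩ <;> rw [Real.norm_eq_abs, add_mul] <;> linarith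
  · have := neg_pos.2 hm
    positivity
  · have hm' := neg_pos.2 hm
    have hm0 := hm.ne
    rw [abs_of_pos hpos] at hle
    have h1 : |rb w| ≤ l / -m / 2 * ra w := hle.trans (by gcongr; exact min_le_left _ _)
    have h2 : |rb w| ≤ l / -m * ((A - m) / (2 * (l - A))) * ra w :=
      hle.trans (by gcongr; exact min_le_right _ _)
    have hlr : 0 < l * ra w := mul_pos hl hpos
    have h1' : -m * |rb w| ≤ l * ra w / 2 := by
      calc -m * |rb w| ≤ -m * (l / -m / 2 * ra w) := by gcongr
        _ = l * ra w / 2 := by field_simp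
    have h2' : (l - A) * (-m * |rb w|) ≤ (A - m) * (l * ra w) / 2 := by
      calc (l - A) * (-m * |rb w|)
          ≤ (l - A) * (-m * (l / -m * ((A - m) / (2 * (l - A))) * ra w)) := by gcongr
        _ = (A - m) * (l * ra w) / 2 := by field_simp
    have h3 : -m * rb w ≤ -m * |rb w| := by gcongr; exact le_abs_self _
    have h4 : m * rb w ≤ -m * |rb w| := by
      have := neg_le_abs (rb w)
      nlinarith
    have e1 := hw1 (J w)
    have e0 := hw0 (J w)
    rw [hraJ, hrbJ] at e0 e1
    refine Fin.forall_fin_two.2 ⟨?_, ?_⟩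
    · refine pos_of_mul_pos_right (a := C * (l - m)) ?_ (by positivity)
      rw [e0]
      have := mul_le_mul_of_nonneg_left h3 hlA.le
      have := mul_pos hAm hlr
      linarith
    · refine pos_of_mul_pos_right (a := l - m) ?_ hlm'.le
      rw [e1]
      linarith

/-- The solution in the region that emanates from `ξ` is unique up to translation of time. Near
`-∞` the difference of such a solution and `ξ` lies in a narrow cone around the unstable eigenvector,
on the side of the region, so a suitable translation of one solution agrees with the other in the
unstable coordinate at one time. By the cone condition they then agree in the other coordinate. -/
theorem exists_shift_of_tendsto_atBot (hS : S.Admissible) {ξ η : Fin 2 → ℝ}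
    (hξ : ∀ i, S.rate i ξ = 0) (hη : ∀ i, S.rate i η = 0) (hlt : ∀ i, η i < ξ i)
    {Y Z : ℝ → Fin 2 → ℝ}
    (hY : ∀ t, HasDerivAt Y (S.vf (Y t)) t) (hY0 : Y 0 ∈ S.region) (hYne : Y 0 ≠ ξ)
    (hYlim : Tendsto Y atBot (𝓝 ξ))
    (hZ : ∀ t, HasDerivAt Z (S.vf (Z t)) t) (hZ0 : Z 0 ∈ S.region) (hZne : Z 0 ≠ ξ)
    (hZlim : Tendsto Z atBot (𝓝 ξ)) : ∃ c, ∀ u, Z u = Y (u + c) := by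
  have hmem := mem_region_of_rate_eq_zero hξ
  have hξpos := fun i => pos_of_rate_nonneg (hmem i)
  have p0 := hξpos 0
  have p1 := hξpos 1
  have c0 := S.c_pos 0
  have c1 := S.c_pos 1
  have hC1 : ContDiff ℝ 1 S.vf := contDiff_vf
  set J := fderiv ℝ S.vf ξ with hJ
  have hstrict : HasStrictFDerivAt S.vf J ξ := hC1.contDiffAt.hasStrictFDerivAt one_ne_zero
  have hJi : ∀ w i, J w i = -(ξ i *
      ((S.a i - 2 * S.b i * ξ i) * w i - 2 * S.c 0 * ξ 0 * w 0 - 2 * S.c 1 * ξ 1 * w 1)) := by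
    intro w i
    rw [hJ, fderiv_vf_apply, hξ i, mul_zero, zero_add]
  have hsad := saddle_of_lt hS hη hξ hlt
  obtain ⟨l, m, ra, rb, κ, ε, hl, hm, hra, hrb, hnorm, hε, hcone⟩ := exists_left_eigenvectors
    (J := J) (A := -(ξ 0 * (S.a 0 - 2 * S.b 0 * ξ 0 - 2 * S.c 0 * ξ 0)))
    (B := ξ 0 * (2 * S.c 1 * ξ 1)) (C := ξ 1 * (2 * S.c 0 * ξ 0))
    (D := -(ξ 1 * (S.a 1 - 2 * S.b 1 * ξ 1 - 2 * S.c 1 * ξ 1)))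
    (fun w => by rw [hJi]; ring) (fun w => by rw [hJi]; ring) (by positivity) (by positivity)
    (by nlinarith [mul_lt_mul_of_pos_left hsad (mul_pos p0 p1)])
  obtain ⟨U, hU, hUc⟩ := exists_cone_condition hstrict hl hm hra hrb hnorm hε
  have heq : ∀ w, ra w = 0 → |rb w| ≤ ε * |ra w| → w = 0 := by
    intro w h1 h2
    rw [h1, abs_zero, mul_zero] at h2
    have := hnorm w
    rw [h1, le_antisymm h2 (abs_nonneg _)] at this
    simpa using this
  have hconst : ∀ {P : Fin 2 → ℝ}, (∀ i, S.rate i P = 0) →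
      ∀ t : ℝ, HasDerivAt (fun _ : ℝ => P) (S.vf P) t := by
    intro P hP t
    rw [vf_eq_zero hP]; exact hasDerivAt_const t P
  have hside : ∀ W : ℝ → Fin 2 → ℝ, (∀ t, HasDerivAt W (S.vf (W t)) t) → W 0 ∈ S.region →
      W 0 ≠ ξ → Tendsto W atBot (𝓝 ξ) → ∃ T, ∀ t ≤ T, W t ∈ U ∧ ra (W t - ξ) < 0 := by
    intro W hW hW0 hWne hWlim
    obtain ⟨T', hT'⟩ := eventually_atBot.1 (hWlim.eventually hU)
    refine ⟨min T' 0, fun t ht => ⟨hT' t (ht.trans (min_le_left _ _)), ?_⟩⟩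
    have hc := hUc W (fun _ => ξ) t (fun s _ => hW s) (fun s _ => hconst hξ s)
      (fun s hs => hT' s (hs.trans (ht.trans (min_le_left _ _))))
      (fun _ _ => mem_of_mem_nhds hU) hWlim tendsto_const_nhds
    by_contra! h
    rcases h.eq_or_lt with h0 | hpos
    · have hWξ : W t = ξ := sub_eq_zero.1 (heq _ h0.symm hc)
      exact hWne (congrFun (eq_of_hasDerivAt_of_contDiff hC1 hW (hconst hξ) hWξ) 0)
    · -- On the other side of `ξ` both rates are negative, and then they are nonpositive at time `0`.
      have hneg : ∀ i, 0 ≤ (-1 : ℝ) * S.rate i (W t) := by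
        intro i
        have h1 := hcone _ hpos hc i
        have h2 := S.rate_add i ξ (W t - ξ)
        rw [add_sub_cancel, hξ i] at h2
        rw [hJi] at h1
        have h3 : (S.a i - 2 * S.b i * ξ i) * (W t - ξ) i - 2 * S.c 0 * ξ 0 * (W t - ξ) 0
            - 2 * S.c 1 * ξ 1 * (W t - ξ) 1 < 0 := by
          by_contra! h4
          linarith [mul_nonneg (hξpos i).le h4]
        have hb := S.b_pos i
        have h4 : 0 ≤ S.b i * (W t - ξ) i ^ 2 + S.c 0 * (W t - ξ) 0 ^ 2
            + S.c 1 * (W t - ξ) 1 ^ 2 := by positivity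
        linarith
      have ht0 : t ≤ 0 := ht.trans (min_le_right _ _)
      have hend := mul_rate_nonneg (S := S) (Y := W) (χ := fun _ => 1) (a := t) (b := 0)
        (fun u _ => by simpa using (hW u).hasDerivWithinAt) continuousOn_const
        (fun _ _ => zero_le_one) (-1) hneg 0 ⟨ht0, le_rfl⟩
      have hstat : ∀ i, S.rate i (W 0) = 0 := fun i => le_antisymm (by linarith [hend i]) (hW0 i)
      have hWη : W 0 = η := (eq_or_eq_of_rate_eq_zero hS hη hξ hlt hstat).resolve_left hWne
      have hWc := eq_of_hasDerivAt_of_contDiff hC1 hW (hconst hη) hWη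
      rw [hWc] at hWlim
      have := tendsto_nhds_unique hWlim tendsto_const_nhds
      exact (hlt 0).ne (congrFun this 0).symm
  obtain ⟨T₁, hT₁⟩ := hside Y hY hY0 hYne hYlim
  obtain ⟨T₂, hT₂⟩ := hside Z hZ hZ0 hZne hZlim
  have hlim0 : ∀ W : ℝ → Fin 2 → ℝ, Tendsto W atBot (𝓝 ξ) →
      Tendsto (fun t => ra (W t - ξ)) atBot (𝓝 0) := by
    intro W hW
    have h1 : Tendsto (fun t => W t - ξ) atBot (𝓝 0) := by simpa using hW.sub_const ξ
    exact map_zero ra ▸ (ra.continuous.tendsto 0).comp h1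
  obtain ⟨t₀, ht₀, ht₀'⟩ := (((hlim0 Y hYlim).eventually_const_lt (hT₂ T₂ le_rfl).2).and
    (eventually_le_atBot T₁)).exists
  obtain ⟨s, hs, hs'⟩ := (((hlim0 Z hZlim).eventually_const_lt (hT₁ t₀ ht₀').2).and
    (eventually_le_atBot T₂)).exists
  have hZc : Continuous Z := continuous_iff_continuousAt.2 fun t => (hZ t).continuousAt
  obtain ⟨u₁, hu₁, hval⟩ := intermediate_value_Icc' hs'
    (f := fun t => ra (Z t - ξ)) (by fun_prop)
    (show ra (Y t₀ - ξ) ∈ Icc (ra (Z T₂ - ξ)) (ra (Z s - ξ)) from ⟨ht₀.le, hs.le⟩)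
  have hW : ∀ t, HasDerivAt (fun u => Z (u + (u₁ - t₀))) (S.vf (Z (t + (u₁ - t₀)))) t :=
    fun t => (hZ _).comp_add_const t _
  have hc := hUc Y (fun u => Z (u + (u₁ - t₀))) t₀ (fun t _ => hY t) (fun t _ => hW t)
    (fun t ht => (hT₁ t (ht.trans ht₀')).1)
    (fun t ht => (hT₂ _ (by linarith [hu₁.2])).1) hYlim
    (hZlim.comp (tendsto_atBot_add_const_right _ _ tendsto_id))
  have hmeet : ra (Y t₀ - Z (t₀ + (u₁ - t₀))) = 0 := by
    rw [add_sub_cancel, map_sub]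
    simp only [map_sub] at hval
    linarith
  have hYZ := eq_of_hasDerivAt_of_contDiff hC1 hY hW (sub_eq_zero.1 (heq _ hmeet hc))
  refine ⟨t₀ - u₁, fun u => ?_⟩
  rw [hYZ]
  congr 1
  ring

end Coeffs

/-! ### Specialization to the given coefficients -/

namespace QKFlow

theorem q_pos {n : Fin 2 → ℕ} {Λ : Fin 2 → ℝ} (hΛ : ∀ i, 0 < Λ i) (i : Fin 2) : 0 < q n Λ i :=
  div_pos (hΛ i) (by positivity)

/-- The system `dY_i/du = -Y_i F_i(Y)` as an instance of `Coeffs`. -/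
def coeffs (n : Fin 2 → ℕ) (hn : ∀ i, 1 ≤ n i) (Λ : Fin 2 → ℝ) (hΛ : ∀ i, 0 < Λ i) : Coeffs where
  a i := 2 * ((n i : ℝ) + 2) * q n Λ i
  b i := 6 * q n Λ i ^ 2
  c i := 4 * (n i : ℝ) * q n Λ i ^ 2
  a_pos i := by have := q_pos (n := n) hΛ i; positivity
  b_pos i := by have := q_pos (n := n) hΛ i; positivity
  c_pos i := by
    have := q_pos (n := n) hΛ i
    have : (0 : ℝ) < n i := by exact_mod_cast hn i
    positivity

variable {n : Fin 2 → ℕ} (hn : ∀ i, 1 ≤ n i) {Λ : Fin 2 → ℝ} (hΛ : ∀ i, 0 < Λ i)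

theorem energy_coeffs (Y : Fin 2 → ℝ) : (coeffs n hn Λ hΛ).energy Y = E n Λ Y := by
  simp only [Coeffs.energy, coeffs, E, Fin.sum_univ_two]
  ring

theorem rate_coeffs (i : Fin 2) (Y : Fin 2 → ℝ) : (coeffs n hn Λ hΛ).rate i Y = F n Λ i Y := by
  rw [Coeffs.rate, energy_coeffs]
  rfl

theorem vf_coeffs : (coeffs n hn Λ hΛ).vf = field n Λ := by
  ext Y i
  rw [Coeffs.vf, rate_coeffs]
  rfl

theorem region_coeffs : (coeffs n hn Λ hΛ).region = Omega1 n Λ := by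
  ext Y
  simp only [Coeffs.region, Omega1, rate_coeffs]

/-- The point `Y_i = 1 / (2 Λ_i)` is interior to `Ω₁`. For `x_i = q_i Y_i` in the region,
`(4 n_i + 6) x_i² - 2 (n_i + 2) x_i + 1/2 < 0`, whereas the left-hand side is nonnegative for
`6 x_i ≥ n_i + 2`. -/
theorem admissible_coeffs : (coeffs n hn Λ hΛ).Admissible where
  exists_interior := by
    refine ⟨fun i => 1 / (2 * Λ i), fun i => ?_⟩
    have hx : ∀ j, q n Λ j * (1 / (2 * Λ j)) = 1 / (2 * ((n j : ℝ) + 2)) := by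
      intro j
      have := (hΛ j).ne'
      rw [q]; field_simp
    have hn' : ∀ j, (1 : ℝ) ≤ n j := fun j => by exact_mod_cast hn j
    -- `n / (n + 2)²` is largest for `n = 2`.
    have h1 : ∀ j, 4 * (n j : ℝ) * (1 / (2 * ((n j : ℝ) + 2))) ^ 2 ≤ 1 / 8 := by
      intro j
      have := hn' j
      rw [div_pow, one_pow, mul_one_div, div_le_iff₀ (by positivity)]
      nlinarith [sq_nonneg ((n j : ℝ) - 2)]
    have h2 : 6 * (1 / (2 * ((n i : ℝ) + 2))) ^ 2 ≤ 1 / 6 := by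
      have := hn' i
      rw [div_pow, one_pow, mul_one_div, div_le_iff₀ (by positivity)]
      nlinarith
    have h3 : 2 * ((n i : ℝ) + 2) * (1 / (2 * ((n i : ℝ) + 2))) = 1 := by
      field_simp
    rw [← hx] at h2 h3
    have h10 := h1 0
    have h11 := h1 1
    rw [← hx] at h10 h11
    simp only [Coeffs.rate, Coeffs.energy, coeffs]
    nlinarith
  two_b_mul_lt := by
    intro Y hY i
    have hYpos : ∀ j, 0 < Y j := fun j => Coeffs.pos_of_rate_nonneg (hY j)
    have hq := fun j => q_pos (n := n) hΛ j
    have hx := fun j => mul_pos (hq j) (hYpos j)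
    have hn' : ∀ j, (1 : ℝ) ≤ n j := fun j => by exact_mod_cast hn j
    have hE : 4 * (n i : ℝ) * (q n Λ i * Y i) ^ 2 + 1 / 2 < E n Λ Y := by
      have h0 : 0 < 4 * (n 0 : ℝ) * (q n Λ 0 * Y 0) ^ 2 :=
        mul_pos (by linarith [hn' 0]) (pow_pos (hx 0) 2)
      have h1 : 0 < 4 * (n 1 : ℝ) * (q n Λ 1 * Y 1) ^ 2 :=
        mul_pos (by linarith [hn' 1]) (pow_pos (hx 1) 2)
      simp only [E, Fin.sum_univ_two, mul_pow] at *
      fin_cases i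
      · simp only [Fin.zero_eta]; linarith
      · simp only [Fin.mk_one]; linarith
    have hF := hY i
    rw [rate_coeffs, F] at hF
    have hlt : (4 * (n i : ℝ) + 6) * (q n Λ i * Y i) ^ 2
        - 2 * ((n i : ℝ) + 2) * (q n Λ i * Y i) + 1 / 2 < 0 := by nlinarith
    have hni := hn' i
    have hqi := hq i
    suffices h : 6 * (q n Λ i * Y i) < n i + 2 by
      simp only [coeffs]; nlinarith
    by_contra! h
    generalize q n Λ i * Y i = x at *
    generalize (n i : ℝ) = k at *
    obtain ⟨t, ht⟩ : ∃ t, x = (k + 2) / 6 + t := ⟨_, (add_sub_cancel _ _).symm⟩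
    have ht0 : 0 ≤ t := by linarith
    have key : (4 * k + 6) * x ^ 2 - 2 * (k + 2) * x + 1 / 2 =
        (k - 1) * (4 * k ^ 2 + 14 * k + 6) / 36 + (4 * k + 6) * t ^ 2
          + 4 * (k + 2) * k / 3 * t := by
      rw [ht]; ring
    have hk : 0 ≤ k - 1 := by linarith
    have : 0 ≤ (k - 1) * (4 * k ^ 2 + 14 * k + 6) / 36 + (4 * k + 6) * t ^ 2
          + 4 * (k + 2) * k / 3 * t := by positivity
    linarith

end QKFlow

/-! ### Eigenvalues at the saddle point and the phase portrait -/

theorem charpoly_fin_two_eq {M : Matrix (Fin 2) (Fin 2) ℝ} {l m : ℝ} (hs : l + m = M 0 0 + M 1 1)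
    (hp : l * m = M 0 0 * M 1 1 - M 0 1 * M 1 0) :
    M.charpoly = (Polynomial.X - Polynomial.C l) * (Polynomial.X - Polynomial.C m) := by
  rw [Matrix.charpoly_fin_two, Matrix.trace_fin_two, Matrix.det_fin_two, ← hs, ← hp]
  simp only [map_add, map_mul]
  ring

/-- At `ξ` the Jacobian matrix is conjugate to `α - E(ξ)` by `diag(ξ₀, ξ₁)`, and its determinant is
negative. -/
theorem QKFlow.exists_eigenvalues {n : Fin 2 → ℕ} (hn : ∀ i, 1 ≤ n i) {Λ : Fin 2 → ℝ}
    (hΛ : ∀ i, 0 < Λ i) {ξ η : Fin 2 → ℝ} (hξ : ∀ i, (coeffs n hn Λ hΛ).rate i ξ = 0)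
    (hη : ∀ i, (coeffs n hn Λ hΛ).rate i η = 0) (hlt : ∀ i, η i < ξ i) :
    ∃ ρ₁ ρ₂ : ℝ,
      (alpha n Λ ξ).charpoly =
        (Polynomial.X - Polynomial.C ρ₁) * (Polynomial.X - Polynomial.C ρ₂) ∧
      (jacobian n Λ ξ).charpoly =
        (Polynomial.X - Polynomial.C (-E n Λ ξ + ρ₁)) *
          (Polynomial.X - Polynomial.C (-E n Λ ξ + ρ₂)) ∧
      -E n Λ ξ + ρ₂ < 0 ∧ 0 < -E n Λ ξ + ρ₁ := by
  have hpos := fun i => Coeffs.pos_of_rate_nonneg (hξ i).ge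
  set S := coeffs n hn Λ hΛ with hS
  have hJ : ∀ i j, jacobian n Λ ξ i j = -(ξ i * ((S.a i - 2 * S.b i * ξ i) *
      (Pi.single j 1 : Fin 2 → ℝ) i - 2 * S.c 0 * ξ 0 * (Pi.single j 1 : Fin 2 → ℝ) 0
      - 2 * S.c 1 * ξ 1 * (Pi.single j 1 : Fin 2 → ℝ) 1)) := by
    intro i j
    rw [jacobian, LinearMap.toMatrix'_apply, ← vf_coeffs hn hΛ, ContinuousLinearMap.coe_coe,
      Coeffs.fderiv_vf_apply, hξ i, mul_zero, zero_add]
  have J00 : jacobian n Λ ξ 0 0 = -(ξ 0 * (S.a 0 - 2 * S.b 0 * ξ 0 - 2 * S.c 0 * ξ 0)) := by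
    simp [hJ]
  have J01 : jacobian n Λ ξ 0 1 = ξ 0 * (2 * S.c 1 * ξ 1) := by simp [hJ]
  have J10 : jacobian n Λ ξ 1 0 = ξ 1 * (2 * S.c 0 * ξ 0) := by simp [hJ]
  have J11 : jacobian n Λ ξ 1 1 = -(ξ 1 * (S.a 1 - 2 * S.b 1 * ξ 1 - 2 * S.c 1 * ξ 1)) := by
    simp [hJ]
  have α00 : alpha n Λ ξ 0 0 = S.b 0 * ξ 0 ^ 2 + 2 * S.c 0 * ξ 0 ^ 2 := by
    simp [alpha, hS, coeffs]; ring
  have α01 : alpha n Λ ξ 0 1 = 2 * S.c 1 * ξ 1 ^ 2 := by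
    change 8 * (n 1 : ℝ) * q n Λ 1 ^ 2 * ξ 1 ^ 2 = 2 * (4 * (n 1 : ℝ) * q n Λ 1 ^ 2) * ξ 1 ^ 2
    ring
  have α10 : alpha n Λ ξ 1 0 = 2 * S.c 0 * ξ 0 ^ 2 := by
    change 8 * (n 0 : ℝ) * q n Λ 0 ^ 2 * ξ 0 ^ 2 = 2 * (4 * (n 0 : ℝ) * q n Λ 0 ^ 2) * ξ 0 ^ 2
    ring
  have α11 : alpha n Λ ξ 1 1 = S.b 1 * ξ 1 ^ 2 + 2 * S.c 1 * ξ 1 ^ 2 := by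
    simp [alpha, hS, coeffs]; ring
  have hE : ∀ i, E n Λ ξ = S.a i * ξ i - S.b i * ξ i ^ 2 := fun i => by
    rw [← energy_coeffs hn hΛ]
    exact (sub_eq_zero.1 (hξ i)).symm
  have hE0 := hE 0
  have hE1 := hE 1
  -- At `ξ` the Jacobian matrix and `α - E` have the same diagonal, and the same product of the
  -- off-diagonal entries.
  have d0 : alpha n Λ ξ 0 0 = jacobian n Λ ξ 0 0 + E n Λ ξ := by
    rw [α00, J00, hE0]; ring
  have d1 : alpha n Λ ξ 1 1 = jacobian n Λ ξ 1 1 + E n Λ ξ := by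
    rw [α11, J11, hE1]; ring
  have d2 : alpha n Λ ξ 0 1 * alpha n Λ ξ 1 0 = jacobian n Λ ξ 0 1 * jacobian n Λ ξ 1 0 := by
    rw [α01, α10, J01, J10]; ring
  have hdet : jacobian n Λ ξ 0 0 * jacobian n Λ ξ 1 1 <
      jacobian n Λ ξ 0 1 * jacobian n Λ ξ 1 0 := by
    have := mul_lt_mul_of_pos_left
      (Coeffs.saddle_of_lt (admissible_coeffs hn hΛ) hη hξ hlt) (mul_pos (hpos 0) (hpos 1))
    rw [J00, J01, J10, J11]
    linarith
  obtain ⟨l, m, hl, hm, hsum, hprod⟩ := Coeffs.exists_roots_of_det_neg hdet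
  refine ⟨E n Λ ξ + l, E n Λ ξ + m, charpoly_fin_two_eq ?_ ?_, ?_, by linarith, by linarith⟩
  · rw [d0, d1]; linarith
  · rw [d0, d1, d2]; linear_combination hprod + E n Λ ξ * hsum
  · rw [neg_add_cancel_left, neg_add_cancel_left]
    exact charpoly_fin_two_eq hsum hprod

end

theorem mainTheorem8 (n : Fin 2 → ℕ) (hn : ∀ i, 1 ≤ n i) (Λ : Fin 2 → ℝ) (hΛ : ∀ i, 0 < Λ i) :
    ∃ ξ η : Fin 2 → ℝ,
      -- `ξ` and `η` are the two stationary points off the coordinate axes, `ξ` the larger one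
      {Y : Fin 2 → ℝ | (∀ i, Y i ≠ 0) ∧ QKFlow.field n Λ Y = 0} = {ξ, η} ∧
      (∀ i, 0 < η i ∧ η i < ξ i) ∧
      -- solutions starting in `Ω₁ \ {ξ}` exist for all forward time and converge to `η`
      (∀ p ∈ QKFlow.Omega1 n Λ \ {ξ},
        (∃ Y : ℝ → Fin 2 → ℝ, QKFlow.IsSolutionOn n Λ Y (Set.Ici 0) ∧ Y 0 = p) ∧
        ∀ Y : ℝ → Fin 2 → ℝ, QKFlow.IsSolutionOn n Λ Y (Set.Ici 0) → Y 0 = p →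
          Filter.Tendsto Y Filter.atTop (nhds η)) ∧
      -- exactly one of them, up to translation of `u`, emanates from `ξ`
      (∃ Y : ℝ → Fin 2 → ℝ,
        (QKFlow.IsSolutionOn n Λ Y Set.univ ∧ Y 0 ∈ QKFlow.Omega1 n Λ \ {ξ} ∧
          Filter.Tendsto Y Filter.atBot (nhds ξ)) ∧
        ∀ Z : ℝ → Fin 2 → ℝ, QKFlow.IsSolutionOn n Λ Z Set.univ →
          Z 0 ∈ QKFlow.Omega1 n Λ \ {ξ} → Filter.Tendsto Z Filter.atBot (nhds ξ) →
          ∃ c : ℝ, ∀ u, Z u = Y (u + c)) ∧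
      -- the eigenvalues of the linearization at `ξ` are `-E(ξ) + ρ₂ < 0 < -E(ξ) + ρ₁`
      (∃ ρ₁ ρ₂ : ℝ,
        (QKFlow.alpha n Λ ξ).charpoly =
          (Polynomial.X - Polynomial.C ρ₁) * (Polynomial.X - Polynomial.C ρ₂) ∧
        (QKFlow.jacobian n Λ ξ).charpoly =
          (Polynomial.X - Polynomial.C (-QKFlow.E n Λ ξ + ρ₁)) *
            (Polynomial.X - Polynomial.C (-QKFlow.E n Λ ξ + ρ₂)) ∧
        -QKFlow.E n Λ ξ + ρ₂ < 0 ∧ 0 < -QKFlow.E n Λ ξ + ρ₁) := by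
  have hS := QKFlow.admissible_coeffs hn hΛ
  obtain ⟨ξ, η, hξ, hη, hlt, hall⟩ := Coeffs.exists_stationary_points hS
  have hηpos : ∀ i, 0 < η i := fun i => Coeffs.pos_of_rate_nonneg (hη i).ge
  have hξpos : ∀ i, 0 < ξ i := fun i => Coeffs.pos_of_rate_nonneg (hξ i).ge
  refine ⟨ξ, η, ?_, fun i => ⟨hηpos i, hlt i⟩, ?_, ?_, QKFlow.exists_eigenvalues hn hΛ hξ hη hlt⟩
  · rw [← QKFlow.vf_coeffs hn hΛ]
    ext Y
    simp only [mem_insert_iff, mem_singleton_iff]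
    constructor
    · rintro ⟨hne, hzero⟩
      refine hall Y fun i => ?_
      simpa [Coeffs.vf, hne i] using congrFun hzero i
    · rintro (rfl | rfl)
      · exact ⟨fun i => (hξpos i).ne', Coeffs.vf_eq_zero hξ⟩
      · exact ⟨fun i => (hηpos i).ne', Coeffs.vf_eq_zero hη⟩
  · rw [← QKFlow.region_coeffs hn hΛ]
    simp only [QKFlow.IsSolutionOn, ← QKFlow.vf_coeffs hn hΛ]
    rintro p ⟨hp, hpξ⟩
    refine ⟨?_, ?_⟩
    · obtain ⟨Y, hY0, hY⟩ := Coeffs.exists_forward_solution hS hp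
      exact ⟨Y, hY, hY0⟩
    · rintro Y hY rfl
      exact Coeffs.tendsto_of_mem_region hS hξ hη hlt hY hp hpξ
  · rw [← QKFlow.region_coeffs hn hΛ]
    simp only [QKFlow.IsSolutionOn, ← QKFlow.vf_coeffs hn hΛ, hasDerivWithinAt_univ, mem_univ,
      forall_const]
    obtain ⟨Y, hY, hY0, hYξ, hYlim⟩ := Coeffs.exists_connecting_solution hS hξ hη hlt
    exact ⟨Y, ⟨hY, ⟨hY0, hYξ⟩, hYlim⟩, fun Z hZ hZ0 hZlim =>
      Coeffs.exists_shift_of_tendsto_atBot hS hξ hη hlt hY hY0 hYξ hYlim hZ hZ0.1 hZ0.2 hZlim⟩
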